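/- Let $m>1$ and let $L$ be an $m$-periodic link, represented by an $m$-periodic plane diagram $D$, that is, a diagram invariant under the rotation of order $m$ about a point that does not lie on $D$. Let $\mathbb{F}$ be $\mathbb{Q}$ or the field $\mathbb{F}_r$ with $r$ prime, suppose that $m$ is invertible in $\mathbb{F}$, and put $\Lambda_m=\mathbb{F}[\mathbb{Z}_m]$. For $h,t\in\mathbb{F}$ let $C\mathcal{K}^{*}(D;\mathbb{F})$ be the Khovanov-type cochain complex of $D$ (the cube of resolutions) built from the rank two Frobenius algebra $A=\mathbb{F}[X]/(X^2-hX-t)$ with counit $\varepsilon(1)=0$, $\varepsilon(X)=1$ and comultiplication $\Delta(1)=1\otimes X+X\otimes 1-h\,1\otimes 1$, $\Delta(X)=X\otimes X+t\,1\otimes 1$, with its quantum filtration and with the action of $\mathbb{Z}_m$ induced by the rotation. (For $h=t=0$ this is Khovanov homology, for $(h,t)=(0,1)$ Lee homology, and for $(h,t)=(1,0)$ over $\mathbb{F}_2$ filtered Bar-Natan homology.) For a finitely generated $\Lambda_m$-module $M$ let $E\mathcal{K}^{i}(L;M)=\operatorname{Ext}^{i}_{\Lambda_m}(M;C\mathcal{K}^{*}(D;\mathbb{F}))$,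 that is, the $i$-th cohomology of the total complex of $\operatorname{Hom}_{\Lambda_m}(P_a,C\mathcal{K}^{b}(D;\mathbb{F}))$ for a projective resolution $P_\bullet\to M$, with the filtration induced by the quantum filtration, and let \[E\mathcal{K}P(L;M)=\sum_{i,k}t^{i}q^{k}\dim_{\mathbb{F}}\operatorname{Gr}^{k}E\mathcal{K}^{i}(L;M).\] (a) Let $\mathbb{F}=\mathbb{Q}$, let $d\mid m$, and let $M=\mathbb{Q}(\xi_d)=\mathbb{Q}[X]/(\Phi_d)$, where $\Phi_d$ is the $d$-th cyclotomic polynomial and the generator of $\mathbb{Z}_m$ acts as multiplication by $X$. Then $E\mathcal{K}P(L;M)$ is a Laurent polynomial with finite coefficients, and all its coefficients are divisible by $\varphi(d)=\dim_{\mathbb{Q}}\mathbb{Q}(\xi_d)$, where $\varphi$ is Euler's function. (b) Let $\mathbb{F}=\mathbb{F}_r$ with $r\nmid m$, let $\xi_m$ be a primitive $m$-th root of unity in an extension of $\mathbb{F}_r$, let $\chi=\{ar^{k}: k\ge 0\}\subset\mathbb{Z}_m$ be the cyclotomic coset mod $r$ of some $a\in\mathbb{Z}_m$, and let $M=V_\chi=\mathbb{F}_r[X]/(f_\chi)$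 with $f_\chi=\prod_{u\in\chi}(X-\xi_m^{u})\in\mathbb{F}_r[X]$, where the generator of $\mathbb{Z}_m$ acts as multiplication by $X$. Then $E\mathcal{K}P(L;M)$ is a Laurent polynomial with finite coefficients, and all its coefficients are divisible by $\dim_{\mathbb{F}_r}V_\chi$, which equals the multiplicative order $f$ of $r$ modulo $m/\gcd(a,m)$. -/

import Mathlib

/-- The next half-edge counterclockwise around the same crossing. -/
def turn {n : ℕ} : Equiv.Perm (Fin n × ZMod 4) where
  toFun x := (x.1, x.2 + 1)
  invFun x := (x.1, x.2 - 1)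
  left_inv x := by simp
  right_inv x := by simp

/-- An oriented link diagram in the plane, up to planar isotopy. It has crossings `0, …, n - 1` and
`l` crossingless closed curves. The four half-edges at a crossing `c` are `(c, 0), …, (c, 3)` in
counterclockwise order; `(c, 0)` and `(c, 2)` belong to the lower strand, `(c, 1)` and `(c, 3)` to the
upper one. `glue` exchanges the two ends of every edge of the underlying four-valent graph, and
`out x` says that the orientation of the link leaves the crossing along the half-edge `x`.
The last field says that the four-valent graph, with this cyclic order at its vertices, is a plane
graph: it is Euler's formula `V - E + F = 2 * (number of components)` with `V = n`, `E = 2 n`, where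
the faces are the orbits of `turn ∘ glue` and the components are the classes generated by `turn` and
`glue`. (The numbering of the crossings only serves to write down signs.) -/
structure LinkDiagram where
  n : ℕ
  l : ℕ
  glue : Equiv.Perm (Fin n × ZMod 4)
  glue_glue : ∀ x, glue (glue x) = x
  glue_ne : ∀ x, glue x ≠ x
  out : Fin n × ZMod 4 → Bool
  out_glue : ∀ x, out (glue x) = !(out x)
  out_opposite : ∀ c i, out (c, i + 2) = !(out (c, i))
  planar : Nat.card (Quot fun x y => y = turn (glue x)) =
    n + 2 * Nat.card (Quot fun x y => y = turn x ∨ y = glue x)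

namespace LinkDiagram

variable (D : LinkDiagram)

/-- Half-edges. -/
abbrev Half : Type := Fin D.n × ZMod 4

/-- The faces of a plane four-valent graph can be coloured like a checkerboard. -/
theorem exists_checkerboard :
    ∃ ε : D.Half → ZMod 2, (∀ x, ε (D.glue x) = ε x + 1) ∧ ∀ x, ε (turn x) = ε x + 1 := by
  classical
  let Qf := Quot fun x y : D.Half => y = turn (D.glue x)
  let Qe := Quot fun x y : D.Half => y = D.glue x
  let Qc := Quot fun x y : D.Half => y = turn x ∨ y = D.glue x
  let k := ZMod 2
  let _ : Fintype Qf := Fintype.ofFinite _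
  let _ : Fintype Qe := Fintype.ofFinite _
  let _ : Fintype Qc := Fintype.ofFinite _
  have two : ∀ a : ZMod 2, a + a = 0 := by decide
  let e : D.Half → Qe := Quot.mk _
  let p : D.Half → Qf := Quot.mk _
  have he : ∀ x, e (D.glue x) = e x := fun x =>
    (Quot.sound (r := fun x y : D.Half => y = D.glue x) rfl).symm
  have hp : ∀ x, p (turn x) = p (D.glue x) := fun x => by
    have : p (D.glue x) = p (turn (D.glue (D.glue x))) :=
      Quot.sound (r := fun x y : D.Half => y = turn (D.glue x)) rfl
    rw [this, D.glue_glue]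
  -- boundary map from face functions to edge functions
  let bd : (Qf → ZMod 2) →ₗ[ZMod 2] (Qe → ZMod 2) :=
    { toFun := fun g => Quot.lift (fun x => g (p x) + g (p (D.glue x))) (by
        rintro x _ rfl; rw [D.glue_glue, add_comm])
      map_add' := by
        intro g g'; funext q; induction q using Quot.ind
        simp only [Pi.add_apply]; ring
      map_smul' := by
        intro a g; funext q; induction q using Quot.ind
        simp only [Pi.smul_apply, smul_eq_mul, RingHom.id_apply]; ring }
  have hbd : ∀ g x, bd g (e x) = g (p x) + g (p (D.glue x)) := fun g x => rfl
  -- incidence matrix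
  let N : Matrix (Fin D.n) Qe (ZMod 2) := fun c q => ∑ i : ZMod 4, if e (c, i) = q then 1 else 0
  have hN : ∀ w c, N.mulVec w c = ∑ i : ZMod 4, w (e (c, i)) := by
    intro w c
    simp only [Matrix.mulVec, dotProduct, N, Finset.sum_mul, ite_mul, one_mul, zero_mul]
    rw [Finset.sum_comm]
    simp
  have hee : ∀ x y, e x = e y ↔ x = y ∨ x = D.glue y := by
    intro x y
    constructor
    · intro h
      let f : Qe → D.Half → Prop := Quot.lift (fun y z => z = y ∨ z = D.glue y) (by
        rintro y _ rfl; funext z; rw [D.glue_glue]; exact propext or_comm)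
      have h1 : f (e x) x := Or.inl rfl
      rw [h] at h1
      exact h1
    · rintro (rfl | rfl)
      · rfl
      · exact he y
  have hNt : ∀ v x, N.transpose.mulVec v (e x) = v x.1 + v (D.glue x).1 := by
    intro v x
    have h0 : N.transpose.mulVec v (e x) =
        ∑ c, ∑ i : ZMod 4, if e (c, i) = e x then v c else 0 := by
      change ∑ c, (∑ i : ZMod 4, if e (c, i) = e x then (1 : ZMod 2) else 0) * v c = _
      simp only [Finset.sum_mul, ite_mul, one_mul, zero_mul]
    rw [h0, ← Finset.sum_product' (f := fun c i => if e (c, i) = e x then v c else 0)]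
    have : ∀ y : D.Half, (if e (y.1, y.2) = e x then v y.1 else 0) =
        (if y = x then v y.1 else 0) + (if y = D.glue x then v y.1 else 0) := by
      intro y
      have hne := D.glue_ne x
      by_cases h1 : y = x
      · subst h1; simp [hne.symm]
      · by_cases h2 : y = D.glue x
        · subst h2; simp [he, hne]
        · have : ¬ e y = e x := by rw [hee]; tauto
          simp [h1, h2, this]
    rw [Finset.sum_congr rfl fun y _ => this y, Finset.sum_add_distrib]
    simp
  -- dimension counts
  have hkc : ∀ {V : Type} [AddCommGroup V] [Module (ZMod 2) V] [FiniteDimensional (ZMod 2) V]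
      (S : Submodule (ZMod 2) V) (j : S →ₗ[ZMod 2] (Qc → ZMod 2)), Function.Injective j →
      Module.finrank (ZMod 2) S ≤ Fintype.card Qc := by
    intro V _ _ _ S j hj
    have := LinearMap.finrank_le_finrank_of_injective hj
    rwa [Module.finrank_fintype_fun_eq_card] at this
  have hker1 : Module.finrank (ZMod 2) (LinearMap.ker bd) ≤ Fintype.card Qc := by
    have key : ∀ g ∈ LinearMap.ker bd, ∀ x, g (p (D.glue x)) = g (p x) := by
      intro g hg x
      have : bd g (e x) = 0 := by rw [LinearMap.mem_ker.1 hg]; rfl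
      rw [hbd] at this
      have h2 := two (g (p x))
      exact add_left_cancel (this.trans h2.symm)
    let j : LinearMap.ker bd →ₗ[ZMod 2] (Qc → ZMod 2) :=
      { toFun := fun g => Quot.lift (fun x => g.1 (p x)) (by
          rintro x y (rfl | rfl)
          · rw [hp, key _ g.2]
          · rw [key _ g.2])
        map_add' := by intro g g'; funext q; induction q using Quot.ind; rfl
        map_smul' := by intro a g; funext q; induction q using Quot.ind; rfl }
    refine hkc _ j ?_
    intro g g' h
    ext q
    induction q using Quot.ind with | mk x => exact congrFun h (Quot.mk _ x)
  have hker2 : Module.finrank (ZMod 2) (LinearMap.ker N.transpose.mulVecLin) ≤ Fintype.card Qc := by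
    have key : ∀ v ∈ LinearMap.ker N.transpose.mulVecLin, ∀ x : D.Half, v (D.glue x).1 = v x.1 := by
      intro v hv x
      have : N.transpose.mulVec v (e x) = 0 := by
        have := LinearMap.mem_ker.1 hv
        rw [Matrix.mulVecLin_apply] at this
        rw [this]; rfl
      rw [hNt] at this
      exact add_left_cancel (this.trans (two (v x.1)).symm)
    let j : LinearMap.ker N.transpose.mulVecLin →ₗ[ZMod 2] (Qc → ZMod 2) :=
      { toFun := fun v => Quot.lift (fun x => v.1 x.1) (by
          rintro x y (rfl | rfl)
          · rfl
          · rw [key _ v.2])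
        map_add' := by intro g g'; funext q; induction q using Quot.ind; rfl
        map_smul' := by intro a g; funext q; induction q using Quot.ind; rfl }
    refine hkc _ j ?_
    intro g g' h
    ext c
    exact congrFun h (Quot.mk _ (c, 0))
  have hQe : 2 * Fintype.card Qe ≤ 4 * D.n := by
    let f : Qe × Bool → D.Half := fun q => if q.2 then q.1.out else D.glue q.1.out
    have hf : ∀ q, e (f q) = q.1 := by
      intro q
      have h0 : e q.1.out = q.1 := Quot.out_eq _
      by_cases h : q.2 = true
      · simp [f, h, h0]
      · simp [f, h, h0, he]
    have hinj : Function.Injective f := by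
      rintro ⟨q, b⟩ ⟨q', b'⟩ h
      have h1 : q = q' := by have := congrArg e h; rwa [hf, hf] at this
      subst h1
      have hne := D.glue_ne q.out
      cases b <;> cases b'
      · rfl
      · exact (hne h).elim
      · exact (hne h.symm).elim
      · rfl
    have := Fintype.card_le_of_injective f hinj
    rw [Fintype.card_prod, Fintype.card_prod, Fintype.card_bool, Fintype.card_fin, ZMod.card]
      at this
    omega
  have hplan : Fintype.card Qf = D.n + 2 * Fintype.card Qc := by
    have := D.planar
    rwa [Nat.card_eq_fintype_card, Nat.card_eq_fintype_card] at this
  have r1 := LinearMap.finrank_range_add_finrank_ker bd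
  have r2 := LinearMap.finrank_range_add_finrank_ker N.mulVecLin
  have r3 := LinearMap.finrank_range_add_finrank_ker N.transpose.mulVecLin
  have r4 := N.rank_transpose
  simp only [Matrix.rank] at r4
  rw [Module.finrank_fintype_fun_eq_card] at r1 r2 r3
  rw [Fintype.card_fin] at r3
  have hle : LinearMap.range bd ≤ LinearMap.ker N.mulVecLin := by
    rintro _ ⟨g, rfl⟩
    rw [LinearMap.mem_ker, Matrix.mulVecLin_apply]
    funext c
    rw [hN]
    simp only [hbd, ← hp]
    rw [Finset.sum_add_distrib]
    have : ∑ i : ZMod 4, g (p (turn (c, i))) = ∑ i : ZMod 4, g (p (c, i)) :=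
      Equiv.sum_comp (Equiv.addRight (1 : ZMod 4)) (fun i => g (p (c, i)))
    rw [this, two]; rfl
  have heq : LinearMap.range bd = LinearMap.ker N.mulVecLin := by
    apply Submodule.eq_of_le_of_finrank_le hle
    omega
  have h1 : (fun _ => 1 : Qe → ZMod 2) ∈ LinearMap.ker N.mulVecLin := by
    rw [LinearMap.mem_ker, Matrix.mulVecLin_apply]
    funext c
    rw [hN]
    change ∑ i : ZMod 4, (1 : ZMod 2) = 0
    rw [Finset.sum_const, Finset.card_univ, ZMod.card]
    rfl
  rw [← heq] at h1
  obtain ⟨g, hg⟩ := h1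
  have hg' : ∀ x, g (p (D.glue x)) = g (p x) + 1 := by
    intro x
    have : g (p x) + g (p (D.glue x)) = 1 := by rw [← hbd, hg]
    rw [← this, ← add_assoc, two, zero_add]
  exact ⟨fun x => g (p x), hg', fun x => (congrArg g (hp x)).trans (hg' x)⟩


theorem sameCycle_swap_of_not {α : Type} [Finite α] (f f' : Equiv.Perm α) (P : α → Prop)
    (hP : ∀ x, P x → P (f x)) {p q : α} (hq : P q)
    (h : ∀ x, P x → x ≠ p → x ≠ q → f' x = f x) (hp' : f' p = f q)
    (hn : ¬ f.SameCycle p q) : f'.SameCycle p q := by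
  classical
  have hfin : ∃ k, 0 < k ∧ (f ^ k) q = q :=
    ⟨orderOf f, orderOf_pos f, by rw [pow_orderOf_eq_one]; rfl⟩
  obtain ⟨hk0, hk⟩ := Nat.find_spec hfin
  have hmin := fun j => Nat.find_min hfin (m := j)
  set k := Nat.find hfin
  have hPj : ∀ j, P ((f ^ j) q) := by
    intro j
    induction j with
    | zero => exact hq
    | succ j ih => rw [pow_succ']; exact hP _ ih
  have key : ∀ j, j < k → (f' ^ (j + 1)) p = (f ^ (j + 1)) q := by
    intro j
    induction j with
    | zero => intro _; simpa using hp'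
    | succ j ih =>
      intro hj
      rw [pow_succ' f' (j + 1), Equiv.Perm.mul_apply, ih (by omega), pow_succ' f (j + 1),
        Equiv.Perm.mul_apply]
      apply h _ (hPj _)
      · intro h1
        exact hn (Equiv.Perm.SameCycle.symm ⟨(j + 1 : ℕ), by rw [zpow_natCast]; exact h1⟩)
      · intro h1
        exact hmin (j + 1) hj ⟨by omega, h1⟩
  refine ⟨(k : ℕ), ?_⟩
  rw [zpow_natCast]
  have := key (k - 1) (by omega)
  rw [Nat.sub_add_cancel hk0] at this
  rw [this, hk]

theorem not_sameCycle_swap_of {α : Type} [Finite α] (f f' : Equiv.Perm α) (P : α → Prop)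
    (hP : ∀ x, P x → P (f x)) {p q : α} (hp : P p) (hpq : p ≠ q)
    (h : ∀ x, P x → x ≠ p → x ≠ q → f' x = f x) (hq' : f' q = f p)
    (hs : f.SameCycle p q) : ¬ f'.SameCycle p q := by
  classical
  have hfin : ∃ k, (f ^ k) p = q := by
    obtain ⟨i, _, hi⟩ := hs.exists_pow_eq'
    exact ⟨i, hi⟩
  have hk := Nat.find_spec hfin
  have hmin := fun j => Nat.find_min hfin (m := j)
  set k := Nat.find hfin
  have hk0 : 0 < k := by
    rcases Nat.eq_zero_or_pos k with h0 | h0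
    · rw [h0] at hk; exact (hpq hk).elim
    · exact h0
  have hPj : ∀ j, P ((f ^ j) p) := by
    intro j
    induction j with
    | zero => exact hp
    | succ j ih => rw [pow_succ']; exact hP _ ih
  have hne : ∀ j, 0 < j → j ≤ k → (f ^ j) p ≠ p := by
    intro j h0 hj h1
    rcases Nat.lt_or_eq_of_le hj with hj | rfl
    · apply hmin (k - j) (by omega)
      have h2 : (f ^ k) p = (f ^ (k - j)) ((f ^ j) p) := by
        rw [← Equiv.Perm.mul_apply, ← pow_add, Nat.sub_add_cancel hj.le]
      rw [h1, hk] at h2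
      exact h2.symm
    · exact hpq (h1.symm.trans hk)
  have key : ∀ j, j < k → (f' ^ (j + 1)) q = (f ^ (j + 1)) p := by
    intro j
    induction j with
    | zero => intro _; simpa using hq'
    | succ j ih =>
      intro hj
      rw [pow_succ' f' (j + 1), Equiv.Perm.mul_apply, ih (by omega), pow_succ' f (j + 1),
        Equiv.Perm.mul_apply]
      exact h _ (hPj _) (hne _ (by omega) (by omega)) (hmin _ hj)
  have hper : (f' ^ k) q = q := by
    have := key (k - 1) (by omega)
    rw [Nat.sub_add_cancel hk0] at this
    rw [this, hk]
  intro hs'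
  obtain ⟨i, _, hi⟩ := hs'.symm.exists_pow_eq'
  have hi' : (f' ^ (i % k)) q = p := by
    have h3 : ∀ j, (f' ^ (k * j)) q = q := by
      intro j
      induction j with
      | zero => rfl
      | succ j ih => rw [Nat.mul_succ, pow_add, Equiv.Perm.mul_apply, hper, ih]
    rw [← Nat.mod_add_div i k, pow_add, Equiv.Perm.mul_apply, h3] at hi
    exact hi
  have hlt : i % k < k := Nat.mod_lt _ hk0
  rcases Nat.eq_zero_or_pos (i % k) with h0 | h0
  · rw [h0] at hi'; exact hpq hi'.symm
  · have := key (i % k - 1) (by omega)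
    rw [Nat.sub_add_cancel h0, hi'] at this
    exact hne _ h0 hlt.le this.symm

/-- The pieces of the diagram: half-edges and crossingless curves. -/
abbrev Site : Type := D.Half ⊕ Fin D.l

/-- A vertex of the cube of resolutions: the set of the crossings that are given the 1-smoothing. -/
abbrev State : Type := Finset (Fin D.n)

/-- The half-edge to which `x` is joined at its crossing in the state `s`. The 0-smoothing joins `0`
with `1` and `2` with `3`; the 1-smoothing joins `1` with `2` and `3` with `0`. -/
def smooth (s : D.State) (x : D.Half) : D.Half :=
  if (x.2 = 0 ∨ x.2 = 2 ↔ x.1 ∈ s) then (x.1, x.2 - 1) else (x.1, x.2 + 1)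

/-- Two pieces that are adjacent in the resolution of the diagram given by `s`. -/
def Joined (s : D.State) (a b : D.Site) : Prop :=
  ∃ x, a = Sum.inl x ∧ (b = Sum.inl (D.glue x) ∨ b = Sum.inl (D.smooth s x))

/-- The circles of the resolution given by `s`. -/
def Circle (s : D.State) : Type := Quot (D.Joined s)

/-- The circle that contains a given piece. -/
def circle (s : D.State) (a : D.Site) : D.Circle s := Quot.mk _ a

instance (s : D.State) : Finite (D.Circle s) := inferInstanceAs (Finite (Quot _))

/-- In either smoothing of `c` the two arcs near `c` are the one through `strand₀ c` and the one
through `strand₂ c`. -/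
def strand₀ (c : Fin D.n) : D.Site := Sum.inl (c, 0)
/-- See `strand₀`. -/
def strand₂ (c : Fin D.n) : D.Site := Sum.inl (c, 2)

variable {D}

theorem smooth_smooth (s : D.State) (x : D.Half) : D.smooth s (D.smooth s x) = x := by
  obtain ⟨c, i⟩ := x
  have h1 : ∀ i : ZMod 4, (i - 1 = 0 ∨ i - 1 = 2) ↔ ¬ (i = 0 ∨ i = 2) := by decide
  have h2 : ∀ i : ZMod 4, (i + 1 = 0 ∨ i + 1 = 2) ↔ ¬ (i = 0 ∨ i = 2) := by decide
  unfold smooth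
  by_cases h : (i = 0 ∨ i = 2 ↔ c ∈ s)
  · have : ¬ (i - 1 = 0 ∨ i - 1 = 2 ↔ c ∈ s) := by rw [h1]; tauto
    simp only [h, this, if_true, if_false, sub_add_cancel]
  · have : (i + 1 = 0 ∨ i + 1 = 2 ↔ c ∈ s) := by rw [h2]; tauto
    simp only [h, this, if_true, if_false, add_sub_cancel_right]

theorem circle_glue (s : D.State) (x : D.Half) :
    D.circle s (Sum.inl (D.glue x)) = D.circle s (Sum.inl x) :=
  (Quot.sound ⟨x, rfl, Or.inl rfl⟩).symm

theorem circle_smooth (s : D.State) (x : D.Half) :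
    D.circle s (Sum.inl (D.smooth s x)) = D.circle s (Sum.inl x) :=
  (Quot.sound ⟨x, rfl, Or.inr rfl⟩).symm

theorem smooth_even {s : D.State} {c : Fin D.n} {i : ZMod 4} (hi : i = 0 ∨ i = 2) :
    D.smooth s (c, i) = if c ∈ s then (c, i - 1) else (c, i + 1) := by
  unfold smooth; simp [hi]

theorem smooth_odd {s : D.State} {c : Fin D.n} {i : ZMod 4} (hi : ¬ (i = 0 ∨ i = 2)) :
    D.smooth s (c, i) = if c ∈ s then (c, i + 1) else (c, i - 1) := by
  unfold smooth; by_cases h : c ∈ s <;> simp [hi, h]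

theorem smooth_insert_ne {s : D.State} {c : Fin D.n} {x : D.Half} (h : x.1 ≠ c) :
    D.smooth (insert c s) x = D.smooth s x := by
  unfold smooth; simp [h]

/-- Walk along a circle of the resolution `s`. -/
def tau (s : D.State) : Equiv.Perm D.Half :=
  D.glue * ⟨D.smooth s, D.smooth s, smooth_smooth s, smooth_smooth s⟩

theorem tau_apply (s : D.State) (x : D.Half) : tau s x = D.glue (D.smooth s x) := rfl

theorem smooth_color {ε : D.Half → ZMod 2} (h : ∀ x, ε (turn x) = ε x + 1) (s : D.State)
    (x : D.Half) : ε (D.smooth s x) = ε x + 1 := by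
  unfold smooth
  split_ifs
  · have := h (x.1, x.2 - 1)
    have e : turn (x.1, x.2 - 1) = x := by simp [turn]
    rw [e] at this
    rw [this, add_assoc]
    have : (1 : ZMod 2) + 1 = 0 := rfl
    rw [this, add_zero]
  · exact h x

theorem circle_eq_of_sameCycle {s : D.State} {x y : D.Half} (h : (tau s).SameCycle x y) :
    D.circle s (Sum.inl x) = D.circle s (Sum.inl y) := by
  obtain ⟨i, _, hi⟩ := h.exists_pow_eq'
  subst hi
  clear h
  have key : ∀ i : ℕ, D.circle s (Sum.inl x) = D.circle s (Sum.inl ((tau s ^ i) x)) := by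
    intro i
    induction i with
    | zero => rfl
    | succ i ih =>
      rw [pow_succ', Equiv.Perm.mul_apply, tau_apply, circle_glue, circle_smooth]
      exact ih
  exact key i

theorem sameCycle_of_circle_eq {ε : D.Half → ZMod 2} (hg : ∀ x, ε (D.glue x) = ε x + 1)
    (ht : ∀ x, ε (turn x) = ε x + 1) {s : D.State} {x y : D.Half} (hx : ε x = 0) (hy : ε y = 0)
    (h : D.circle s (Sum.inl x) = D.circle s (Sum.inl y)) : (tau s).SameCycle x y := by
  classical
  have two : ∀ a : ZMod 2, a ≠ 0 → a + 1 = 0 := by decide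
  have one : ∀ a : ZMod 2, a = 0 → a + 1 ≠ 0 := by decide
  let ν : D.Half → Quotient (Equiv.Perm.SameCycle.setoid (tau s)) := fun z =>
    if ε z = 0 then Quotient.mk _ z else Quotient.mk _ (D.glue z)
  let f : D.Site → Quotient (Equiv.Perm.SameCycle.setoid (tau s)) ⊕ Fin D.l := Sum.map ν id
  have hf : ∀ a b, D.Joined s a b → f a = f b := by
    rintro _ _ ⟨z, rfl, rfl | rfl⟩
    · simp only [f, Sum.map_inl, Sum.inl.injEq, ν]
      by_cases hz : ε z = 0
      · rw [if_pos hz, if_neg (by rw [hg]; exact one _ hz), D.glue_glue]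
      · rw [if_neg hz, if_pos (by rw [hg]; exact two _ hz)]
    · simp only [f, Sum.map_inl, Sum.inl.injEq, ν]
      by_cases hz : ε z = 0
      · rw [if_pos hz, if_neg (by rw [smooth_color ht]; exact one _ hz)]
        exact Quotient.sound ⟨1, rfl⟩
      · rw [if_neg hz, if_pos (by rw [smooth_color ht]; exact two _ hz)]
        have : (tau s).SameCycle (D.smooth s z) (D.glue z) :=
          ⟨1, by rw [zpow_one, tau_apply, smooth_smooth]⟩
        exact (Quotient.sound this).symm
  have h2 : f (Sum.inl x) = f (Sum.inl y) := congrArg (Quot.lift f hf) h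
  simp only [f, Sum.map_inl, Sum.inl.injEq, ν, hx, hy, if_true] at h2
  exact Quotient.exact h2

/-- Changing the smoothing at one crossing of a plane diagram either merges two circles or splits one. -/
theorem circle_insert_iff {s : D.State} {c : Fin D.n} (hc : c ∉ s) :
    D.circle s (D.strand₀ c) = D.circle s (D.strand₂ c) ↔
      D.circle (insert c s) (D.strand₀ c) ≠ D.circle (insert c s) (D.strand₂ c) := by
  obtain ⟨ε, hg, ht⟩ := D.exists_checkerboard
  have two : ∀ a : ZMod 2, a ≠ 0 → a + 1 = 0 := by decide
  have hcc : c ∈ insert c s := Finset.mem_insert_self c s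
  have hadd : ∀ i, ε (c, i + 1) = ε (c, i) + 1 := fun i => ht (c, i)
  -- the positive half-edges at `c`
  have main : ∀ i : ZMod 4, ε (c, i) = 0 → ε (c, i + 2) = 0 →
      D.smooth (insert c s) (c, i) = D.smooth s (c, i + 2) →
      D.smooth (insert c s) (c, i + 2) = D.smooth s (c, i) →
      (D.circle s (Sum.inl (c, i)) = D.circle s (Sum.inl (c, i + 2)) ↔
      ¬ D.circle (insert c s) (Sum.inl (c, i)) = D.circle (insert c s) (Sum.inl (c, i + 2))) := by
    intro i h0 h2 e1 e2
    have hne : ((c, i) : D.Half) ≠ (c, i + 2) := by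
      have : ∀ i : ZMod 4, i ≠ i + 2 := by decide
      intro h; exact this i (congrArg Prod.snd h)
    have hP : ∀ s : D.State, ∀ x, ε x = 0 → ε (tau s x) = 0 := by
      intro s x hx
      rw [tau_apply, hg, smooth_color ht, hx]; rfl
    have hoff : ∀ x : D.Half, ε x = 0 → x ≠ (c, i) → x ≠ (c, i + 2) →
        tau (insert c s) x = tau s x := by
      rintro ⟨c', j⟩ hx h3 h4
      rw [tau_apply, tau_apply]
      congr 1
      apply smooth_insert_ne
      rintro rfl
      have : ∀ i j : ZMod 4, j = i ∨ j = i + 2 ∨ j = i + 1 ∨ j = i + 2 + 1 := by decide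
      rcases this i j with rfl | rfl | rfl | rfl
      · exact h3 rfl
      · exact h4 rfl
      · rw [hadd, h0] at hx; exact absurd hx (by decide)
      · rw [hadd, h2] at hx; exact absurd hx (by decide)
    have t1 : tau (insert c s) (c, i) = tau s (c, i + 2) := by rw [tau_apply, e1]; rfl
    have t2 : tau (insert c s) (c, i + 2) = tau s (c, i) := by rw [tau_apply, e2]; rfl
    constructor
    · intro h h'
      exact not_sameCycle_swap_of (tau s) (tau (insert c s)) (fun x => ε x = 0) (hP s) h0 hne
        hoff t2 (sameCycle_of_circle_eq hg ht h0 h2 h) (sameCycle_of_circle_eq hg ht h0 h2 h')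
    · intro h
      by_contra h'
      exact h (circle_eq_of_sameCycle (sameCycle_swap_of_not (tau s) (tau (insert c s))
        (fun x => ε x = 0) (hP s) h2 hoff t1 fun hs => h' (circle_eq_of_sameCycle hs)))
  by_cases h0 : ε (c, 0) = 0
  · have h2 : ε (c, 0 + 2) = 0 := by
      have h1 := hadd 0
      have h2 := hadd (0 + 1)
      rw [h1, h0] at h2
      exact h2
    have := main 0 h0 h2 (by
      rw [smooth_even (Or.inl rfl), smooth_even (Or.inr (zero_add _)), if_pos hcc, if_neg hc]
      rfl) (by
      rw [smooth_even (Or.inl rfl), smooth_even (Or.inr (zero_add _)), if_pos hcc, if_neg hc]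
      rfl)
    exact this
  · have h1 : ε (c, 1) = 0 := by
      have h1 := hadd 0
      rw [two _ h0] at h1
      exact h1
    have h3 : ε (c, 1 + 2) = 0 := by
      have h2 := hadd 1
      have h3 := hadd (1 + 1)
      rw [h2, h1] at h3
      exact h3
    have := main 1 h1 h3 (by
      rw [smooth_odd (by decide), smooth_odd (by decide), if_pos hcc, if_neg hc]; rfl) (by
      rw [smooth_odd (by decide), smooth_odd (by decide), if_pos hcc, if_neg hc]; rfl)
    have a0 := circle_smooth s (c, 0)
    have a2 := circle_smooth s (c, 2)
    have b0 := circle_smooth (insert c s) (c, 0)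
    have b2 := circle_smooth (insert c s) (c, 2)
    rw [smooth_even (Or.inl rfl), if_neg hc] at a0
    rw [smooth_even (Or.inr rfl), if_neg hc] at a2
    rw [smooth_even (Or.inl rfl), if_pos hcc] at b0
    rw [smooth_even (Or.inr rfl), if_pos hcc] at b2
    unfold strand₀ strand₂
    rw [← a0, ← a2, ← b0, ← b2, ne_eq, eq_comm (a := D.circle (insert c s) _)]
    exact this

theorem eq_of_circle_eq {α : Type} {s t : D.State} {c : Fin D.n}
    (hst : ∀ x : D.Half, x.1 ≠ c → D.smooth t x = D.smooth s x) (π : D.Site → α)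
    (hπ : ∀ a b, D.circle t a = D.circle t b → π a = π b)
    (hc : π (D.strand₀ c) = π (D.strand₂ c)) {a b : D.Site}
    (hab : D.circle s a = D.circle s b) : π a = π b := by
  have h4 : ∀ i, π (Sum.inl (c, i)) = π (D.strand₀ c) := by
    have h1 : ∀ i : ZMod 4, i = 0 ∨ i = 2 → π (Sum.inl (c, i)) = π (D.strand₀ c) := by
      rintro _ (rfl | rfl)
      · rfl
      · exact hc.symm
    have hsub : ∀ i : ZMod 4, ¬ (i = 0 ∨ i = 2) → (i - 1 = 0 ∨ i - 1 = 2) := by decide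
    have hadd : ∀ i : ZMod 4, ¬ (i = 0 ∨ i = 2) → (i + 1 = 0 ∨ i + 1 = 2) := by decide
    intro i
    by_cases hi : i = 0 ∨ i = 2
    · exact h1 i hi
    · have := hπ _ _ (circle_smooth t (c, i))
      rw [← this, smooth_odd hi]
      split_ifs
      · exact h1 _ (hadd i hi)
      · exact h1 _ (hsub i hi)
  have hJ : ∀ a b, D.Joined s a b → π a = π b := by
    rintro _ _ ⟨x, rfl, rfl | rfl⟩
    · exact (hπ _ _ (circle_glue t x)).symm
    · by_cases hx : x.1 = c
      · obtain ⟨c', i⟩ := x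
        obtain rfl : c' = c := hx
        rw [h4 i]
        unfold smooth
        split_ifs <;> exact (h4 _).symm
      · rw [← hst x hx]
        exact (hπ _ _ (circle_smooth t x)).symm
  exact congrArg (Quot.lift π hJ) hab

theorem circle_transfer {s t : D.State} {c : Fin D.n}
    (hst : ∀ x : D.Half, x.1 ≠ c → D.smooth t x = D.smooth s x) {a b : D.Site}
    (hab : D.circle s a = D.circle s b) :
    D.circle t a = D.circle t b ∨
      (D.circle t a = D.circle t (D.strand₀ c) ∧ D.circle t b = D.circle t (D.strand₂ c)) ∨
      (D.circle t a = D.circle t (D.strand₂ c) ∧ D.circle t b = D.circle t (D.strand₀ c)) := by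
  classical
  have := eq_of_circle_eq hst
    (fun x => if D.circle t x = D.circle t (D.strand₂ c) then D.circle t (D.strand₀ c)
      else D.circle t x)
    (by intro a b h; simp only [h]) (by simp) hab
  split_ifs at this with h1 h2 h2
  · exact Or.inl (h1.trans h2.symm)
  · exact Or.inr (Or.inr ⟨h1, this.symm⟩)
  · exact Or.inr (Or.inl ⟨this, h2⟩)
  · exact Or.inl this

theorem circle_transfer_up {s : D.State} (c : Fin D.n) {a b : D.Site}
    (hab : D.circle s a = D.circle s b) :
    D.circle (insert c s) a = D.circle (insert c s) b ∨
      (D.circle (insert c s) a = D.circle (insert c s) (D.strand₀ c) ∧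
        D.circle (insert c s) b = D.circle (insert c s) (D.strand₂ c)) ∨
      (D.circle (insert c s) a = D.circle (insert c s) (D.strand₂ c) ∧
        D.circle (insert c s) b = D.circle (insert c s) (D.strand₀ c)) :=
  circle_transfer (fun _ h => smooth_insert_ne h) hab

theorem circle_transfer_down {s : D.State} (c : Fin D.n) {a b : D.Site}
    (hab : D.circle (insert c s) a = D.circle (insert c s) b) :
    D.circle s a = D.circle s b ∨
      (D.circle s a = D.circle s (D.strand₀ c) ∧ D.circle s b = D.circle s (D.strand₂ c)) ∨
      (D.circle s a = D.circle s (D.strand₂ c) ∧ D.circle s b = D.circle s (D.strand₀ c)) :=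
  circle_transfer (fun _ h => (smooth_insert_ne h).symm) hab

section Ring

variable {F : Type} [Field F]

variable (D F) in
/-- Polynomials in one variable for every piece of the diagram. -/
abbrev SiteRing : Type := MvPolynomial D.Site F

/-- The Frobenius algebra `A = F[X] / (X² - h X - t)`, with counit `ε(1) = 0`, `ε(X) = 1` and
comultiplication `Δ(1) = 1 ⊗ X + X ⊗ 1 - h 1 ⊗ 1`, `Δ(X) = X ⊗ X + t 1 ⊗ 1`, is the base change of
the universal rank two Frobenius system over `ℤ[h, t]` along the ring homomorphism to `F` given by the
elements `h` and `t` of `F`. The space `A^{⊗ circles of s}` that the cube of resolutions has at the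
vertex `s` is the quotient of the polynomial ring by this ideal: the variable of a piece is `X` in the
tensor factor of the circle that contains the piece. -/
noncomputable def stateIdeal (h t : F) (s : D.State) : Ideal (D.SiteRing F) :=
  Ideal.span ({p | ∃ a, p = MvPolynomial.X a ^ 2 - MvPolynomial.C h * MvPolynomial.X a
      - MvPolynomial.C t} ∪
    {p | ∃ a b, D.circle s a = D.circle s b ∧ p = MvPolynomial.X a - MvPolynomial.X b})

open scoped Classical in
/-- The map `A^{⊗ circles of s} → A^{⊗ circles of s ∪ {c}}` along an edge of the cube sends the
class of `p` to the class of `edgePoly h s c * p`. If two circles are merged, this is the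
multiplication of `A`, so the factor is `1`. If one circle is split, it is `Δ`, that is,
multiplication by the element `Δ(1) = X ⊗ 1 + 1 ⊗ X - h 1 ⊗ 1` of the two new tensor factors. -/
noncomputable def edgePoly (h : F) (s : D.State) (c : Fin D.n) : D.SiteRing F :=
  if D.circle s (D.strand₀ c) = D.circle s (D.strand₂ c) then
    MvPolynomial.X (D.strand₀ c) + MvPolynomial.X (D.strand₂ c) - MvPolynomial.C h
  else 1

theorem quad_mem (h t : F) (s : D.State) (a : D.Site) :
    (MvPolynomial.X a ^ 2 - MvPolynomial.C h * MvPolynomial.X a - MvPolynomial.C t :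
      D.SiteRing F) ∈ stateIdeal h t s :=
  Ideal.subset_span (Or.inl ⟨a, rfl⟩)

theorem sub_mem_of_circle_eq (h t : F) {s : D.State} {a b : D.Site}
    (hab : D.circle s a = D.circle s b) :
    (MvPolynomial.X a - MvPolynomial.X b : D.SiteRing F) ∈ stateIdeal h t s :=
  Ideal.subset_span (Or.inr ⟨a, b, hab, rfl⟩)

/-- The maps along the edges are well defined. -/
theorem edgePoly_mul_mem (h t : F) {s : D.State} {c : Fin D.n} (hc : c ∉ s) {p : D.SiteRing F}
    (hp : p ∈ stateIdeal h t s) : edgePoly h s c * p ∈ stateIdeal h t (insert c s) := by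
  have hiff := circle_insert_iff hc
  suffices H : stateIdeal h t s ≤ Submodule.comap
      (LinearMap.mulLeft (D.SiteRing F) (edgePoly h s c)) (stateIdeal h t (insert c s)) from H hp
  apply Ideal.span_le.2
  rintro q (⟨a, rfl⟩ | ⟨a, b, hab, rfl⟩)
  · exact Ideal.mul_mem_left _ _ (quad_mem h t _ a)
  · change edgePoly h s c * (MvPolynomial.X a - MvPolynomial.X b) ∈ stateIdeal h t (insert c s)
    unfold edgePoly
    split_ifs with hm
    · have hkey : ((MvPolynomial.X (D.strand₀ c) + MvPolynomial.X (D.strand₂ c)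
          - MvPolynomial.C h) * (MvPolynomial.X (D.strand₀ c) - MvPolynomial.X (D.strand₂ c)) :
          D.SiteRing F) ∈ stateIdeal h t (insert c s) := by
        have := Ideal.sub_mem _ (quad_mem h t (insert c s) (D.strand₀ c))
          (quad_mem h t (insert c s) (D.strand₂ c))
        convert this using 1
        ring
      rcases circle_transfer_up c hab with h1 | ⟨h1, h2⟩ | ⟨h1, h2⟩
      · exact Ideal.mul_mem_left _ _ (sub_mem_of_circle_eq h t h1)
      · have e1 := sub_mem_of_circle_eq h t h1
        have e2 := sub_mem_of_circle_eq h t h2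
        have := Ideal.add_mem _ (Ideal.mul_mem_left _ (MvPolynomial.X (D.strand₀ c) +
          MvPolynomial.X (D.strand₂ c) - MvPolynomial.C h) (Ideal.sub_mem _ e1 e2)) hkey
        convert this using 1
        ring
      · have e1 := sub_mem_of_circle_eq h t h1
        have e2 := sub_mem_of_circle_eq h t h2
        have := Ideal.sub_mem _ (Ideal.mul_mem_left _ (MvPolynomial.X (D.strand₀ c) +
          MvPolynomial.X (D.strand₂ c) - MvPolynomial.C h) (Ideal.sub_mem _ e1 e2)) hkey
        convert this using 1
        ring
    · rw [one_mul]
      have h0 : D.circle (insert c s) (D.strand₀ c) = D.circle (insert c s) (D.strand₂ c) := by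
        by_contra h0; exact hm (hiff.2 h0)
      apply sub_mem_of_circle_eq
      rcases circle_transfer_up c hab with h1 | ⟨h1, h2⟩ | ⟨h1, h2⟩
      · exact h1
      · rw [h1, h2, h0]
      · rw [h1, h2, h0]

/-- The faces of the cube commute. -/
theorem edgePoly_comm (h t : F) {s : D.State} {c c' : Fin D.n} (hc : c ∉ s) (hc' : c' ∉ s)
    (hne : c ≠ c') :
    edgePoly h s c * edgePoly h (insert c s) c' - edgePoly h s c' * edgePoly h (insert c' s) c ∈
      stateIdeal h t (insert c (insert c' s)) := by
  have hcomm : insert c' (insert c s) = insert c (insert c' s) := Finset.insert_comm _ _ _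
  have i1 := circle_insert_iff hc
  have i2 := circle_insert_iff hc'
  have i3 := circle_insert_iff (s := insert c s) (c := c') (by
    rw [Finset.mem_insert]; rintro (e | e); exacts [hne e.symm, hc' e])
  have i4 := circle_insert_iff (s := insert c' s) (c := c) (by
    rw [Finset.mem_insert]; rintro (e | e); exacts [hne e, hc e])
  rw [hcomm] at i3
  have u1 := @circle_transfer_up D s c
  have u2 := @circle_transfer_up D s c'
  have u3 := @circle_transfer_up D (insert c s) c'
  have u4 := @circle_transfer_up D (insert c' s) c
  have w1 := @circle_transfer_down D s c
  have w2 := @circle_transfer_down D s c'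
  have w3 := @circle_transfer_down D (insert c s) c'
  have w4 := @circle_transfer_down D (insert c' s) c
  rw [hcomm] at u3 w3
  have m := @sub_mem_of_circle_eq D F _ h t (insert c (insert c' s))
  generalize hA : (D.circle s) = A at *
  generalize hB : D.circle (insert c s) = B at *
  generalize hB' : D.circle (insert c' s) = B' at *
  generalize hE : D.circle (insert c (insert c' s)) = E at *
  unfold edgePoly
  rw [hA, hB, hB']
  generalize D.strand₀ c = a at *
  generalize D.strand₂ c = b at *
  generalize D.strand₀ c' = a' at *
  generalize D.strand₂ c' = b' at *
  clear hA hB hB' hE hcomm hne hc hc'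
  by_cases p1 : A a = A b <;> by_cases p2 : A a' = A b'
  · have q1 := i1.1 p1
    have q2 := i2.1 p2
    by_cases p3 : B a' = B b'
    · have p4 : B' a = B' b := by
        by_contra p4
        have := @w3 a b
        grind
      rw [if_pos p1, if_pos p2, if_pos p3, if_pos p4, mul_comm, sub_self]
      exact Ideal.zero_mem _
    · have p4 : ¬ B' a = B' b := by
        intro p4
        have := @w4 a' b'
        grind
      have e3 : E a' = E b' := by grind
      have e4 : E a = E b := by grind
      have e5 : E a = E a' := by
        have h1 := @u1 a' b' p2
        have h2 := @u3 a a'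
        have h3 := @u3 b a'
        grind
      rw [if_pos p1, if_pos p2, if_neg p3, if_neg p4, mul_one, mul_one]
      have := Ideal.add_mem _ (m e5) (m (e4.symm.trans (e5.trans e3)))
      convert this using 1
      ring
  · have p3 : ¬ B a' = B b' := by
      intro p3
      have := w1 p3
      grind
    have p4 : B' a = B' b := by
      have := u2 p1
      grind
    rw [if_pos p1, if_neg p2, if_neg p3, if_pos p4, mul_one, one_mul, sub_self]
    exact Ideal.zero_mem _
  · have p4 : ¬ B' a = B' b := by
      intro p4
      have := w2 p4
      grind
    have p3 : B a' = B b' := by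
      have := u1 p2
      grind
    rw [if_neg p1, if_pos p2, if_pos p3, if_neg p4, mul_one, one_mul, sub_self]
    exact Ideal.zero_mem _
  · have q1 : B a = B b := by grind
    have q2 : B' a' = B' b' := by grind
    by_cases p3 : B a' = B b'
    · have r := w1 p3
      have r' : (A a' = A a ∧ A b' = A b) ∨ (A a' = A b ∧ A b' = A a) := by grind
      have hfin : B' a = B' b ∧ ((E a' = E a ∧ E b' = E b) ∨ (E a' = E b ∧ E b' = E a)) := by
        have e3 : E a' ≠ E b' := by grind
        rcases r' with ⟨r1, r2⟩ | ⟨r1, r2⟩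
        · have h1 := u2 r1
          have h2 := u2 r2
          have h3 : B' a' = B' a := by grind
          have h4 : B' b' = B' b := by grind
          have h5 := u4 h3
          have h6 := u4 h4
          grind
        · have h1 := u2 r1
          have h2 := u2 r2
          have h3 : B' a' = B' b := by grind
          have h4 : B' b' = B' a := by grind
          have h5 := u4 h3
          have h6 := u4 h4
          grind
      rw [if_neg p1, if_neg p2, if_pos p3, if_pos hfin.1, one_mul, one_mul]
      rcases hfin.2 with ⟨e1, e2⟩ | ⟨e1, e2⟩ <;>
      · have := Ideal.add_mem _ (m e1) (m e2)
        convert this using 1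
        ring
    · have p4 : ¬ B' a = B' b := by
        intro p4
        have r := w2 p4
        have r' : (A a = A a' ∧ A b = A b') ∨ (A a = A b' ∧ A b = A a') := by grind
        rcases r' with ⟨r1, r2⟩ | ⟨r1, r2⟩
        · have h1 := u1 r1
          have h2 := u1 r2
          grind
        · have h1 := u1 r1
          have h2 := u1 r2
          grind
      rw [if_neg p1, if_neg p2, if_neg p3, if_neg p4, mul_one, sub_self]
      exact Ideal.zero_mem _

/-- The sign of `e_c ∧ e_s` against `e_{s ∪ {c}}`, where `e_s` is the exterior product, in increasing
order, of basis vectors `e_c` for `c ∈ s`. -/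
def koszulSign (c : Fin D.n) (s : D.State) : ℤ := ∏ c' ∈ s, if c' < c then -1 else 1

/-- The sign of `π(e_s)` against `e_{π(s)}`: minus one to the number of pairs of elements of `s`
whose order is reversed by `π`. -/
def permSign (π : Equiv.Perm (Fin D.n)) (s : D.State) : ℤ :=
  ∏ z ∈ s.sym2, Sym2.lift ⟨fun x y => if (x < y ↔ π x < π y) then 1 else -1, by
    intro x y
    rcases eq_or_ne x y with rfl | h
    · rfl
    · have h' : π x ≠ π y := fun e => h (π.injective e)
      have e1 : x < y ↔ ¬ y < x := ⟨fun a => a.asymm, fun a => lt_of_le_of_ne (not_lt.1 a) h⟩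
      have e2 : π x < π y ↔ ¬ π y < π x :=
        ⟨fun a => a.asymm, fun a => lt_of_le_of_ne (not_lt.1 a) h'⟩
      simp only [e1, e2, not_iff_not]⟩ z

theorem permSign_mul (π π' : Equiv.Perm (Fin D.n)) (s : D.State) :
    permSign (π * π') s = permSign π (s.map π'.toEmbedding) * permSign π' s := by
  unfold permSign
  rw [Finset.sym2_map, Finset.prod_map, ← Finset.prod_mul_distrib]
  apply Finset.prod_congr rfl
  intro z _
  induction z using Sym2.ind with | _ x y =>
  simp only [Sym2.lift_mk, Function.Embedding.sym2Map_apply, Equiv.coe_toEmbedding, Sym2.map_mk,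
    Equiv.Perm.mul_apply]
  by_cases h1 : x < y <;> by_cases h2 : π' x < π' y <;> by_cases h3 : π (π' x) < π (π' y) <;>
    simp [h1, h2, h3]

theorem permSign_one (s : D.State) : permSign 1 s = 1 := by
  unfold permSign
  apply Finset.prod_eq_one
  intro z _
  induction z using Sym2.ind with | _ x y => simp

theorem permSign_insert (π : Equiv.Perm (Fin D.n)) {s : D.State} {c : Fin D.n} (hc : c ∉ s) :
    permSign π (insert c s) * koszulSign c s =
      koszulSign (π c) (s.map π.toEmbedding) * permSign π s := by
  have h1 : permSign π (insert c s) =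
      (∏ x ∈ s, if (c < x ↔ π c < π x) then 1 else -1) * permSign π s := by
    unfold permSign
    rw [Finset.sym2_insert, Finset.prod_union, Finset.prod_image, Finset.prod_insert hc]
    · simp
    · intro x _ y _ h
      exact Sym2.congr_right.1 h
    · rw [Finset.disjoint_left]
      intro z hz hz'
      obtain ⟨b, _, rfl⟩ := Finset.mem_image.1 hz
      exact hc (Finset.mk_mem_sym2_iff.1 hz').1
  rw [h1, mul_right_comm]
  congr 1
  unfold koszulSign
  rw [Finset.prod_map, ← Finset.prod_mul_distrib]
  apply Finset.prod_congr rfl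
  intro x hx
  have hxc : x ≠ c := fun e => hc (e ▸ hx)
  have hpc : π x ≠ π c := fun e => hxc (π.injective e)
  have e1 : c < x ↔ ¬ x < c := ⟨fun a => a.asymm, fun a => lt_of_le_of_ne (not_lt.1 a) hxc.symm⟩
  have e2 : π c < π x ↔ ¬ π x < π c :=
    ⟨fun a => a.asymm, fun a => lt_of_le_of_ne (not_lt.1 a) hpc.symm⟩
  simp only [e1, e2, Equiv.coe_toEmbedding]
  by_cases h1 : x < c <;> by_cases h2 : π x < π c <;> simp [h1, h2]

theorem koszulSign_anticomm {s : D.State} {c c' : Fin D.n} (hc : c ∉ s) (hc' : c' ∉ s)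
    (hne : c ≠ c') :
    koszulSign c (insert c' s) * koszulSign c' s =
      -(koszulSign c' (insert c s) * koszulSign c s) := by
  unfold koszulSign
  rw [Finset.prod_insert hc', Finset.prod_insert hc]
  rcases lt_or_gt_of_ne hne with h | h
  · simp only [h, h.asymm, if_true, if_false]; ring
  · simp only [h, h.asymm, if_true, if_false]; ring

variable (D F) in
/-- The direct sum over all vertices of the cube of the polynomial rings of which the spaces
`A^{⊗ circles of s}` are quotients. -/
abbrev PreChain : Type := D.State → D.SiteRing F

/-- The differential of the cube of resolutions. -/
noncomputable def preDiff (h : F) : D.PreChain F →ₗ[F] D.PreChain F where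
  toFun f s := ∑ c ∈ s, (koszulSign c (s.erase c) : D.SiteRing F) *
    (edgePoly h (s.erase c) c * f (s.erase c))
  map_add' f g := by
    funext s
    simp only [Pi.add_apply, mul_add, Finset.sum_add_distrib]
  map_smul' a f := by
    funext s
    simp only [Pi.smul_apply, mul_smul_comm, Finset.smul_sum, RingHom.id_apply]

/-- The direct sum of the ideals `stateIdeal h t s`. -/
def stateRel (h t : F) : Submodule F (D.PreChain F) where
  carrier := {f | ∀ s, f s ∈ stateIdeal h t s}
  add_mem' hf hg s := Ideal.add_mem _ (hf s) (hg s)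
  zero_mem' s := Ideal.zero_mem _
  smul_mem' a f hf s := by
    have : (a • f) s = MvPolynomial.C a * f s := by
      rw [Pi.smul_apply, MvPolynomial.smul_eq_C_mul]
    rw [this]
    exact Ideal.mul_mem_left _ _ (hf s)

theorem preDiff_mem (h t : F) {f : D.PreChain F} (hf : f ∈ stateRel h t) :
    preDiff h f ∈ stateRel h t := by
  intro s
  apply Ideal.sum_mem
  intro c hc
  apply Ideal.mul_mem_left
  have := edgePoly_mul_mem h t (Finset.notMem_erase c s) (hf (s.erase c))
  rwa [Finset.insert_erase hc] at this

theorem preDiff_preDiff_mem (h t : F) (f : D.PreChain F) :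
    preDiff h (preDiff h f) ∈ stateRel h t := by
  intro s
  have e1 : preDiff h (preDiff h f) s = ∑ p ∈ s.sigma fun c => s.erase c,
      ((koszulSign p.1 (s.erase p.1) * koszulSign p.2 ((s.erase p.1).erase p.2) : ℤ) :
        D.SiteRing F) * (edgePoly h ((s.erase p.1).erase p.2) p.2 *
        edgePoly h (s.erase p.1) p.1 * f ((s.erase p.1).erase p.2)) := by
    rw [Finset.sum_sigma]
    change ∑ c ∈ s, _ * (_ * ∑ c' ∈ s.erase c, _) = _
    apply Finset.sum_congr rfl
    intro c _
    rw [Finset.mul_sum, Finset.mul_sum]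
    apply Finset.sum_congr rfl
    intro c' _
    push_cast
    ring
  rw [← Ideal.Quotient.eq_zero_iff_mem, e1, map_sum]
  refine Finset.sum_involution (fun p _ => ⟨p.2, p.1⟩) ?_ ?_ ?_ ?_
  · rintro ⟨c, c'⟩ hp
    rw [Finset.mem_sigma, Finset.mem_erase] at hp
    obtain ⟨hc, hne, hc'⟩ := hp
    simp only at hc hne hc'
    obtain ⟨u, hu, hu', rfl⟩ : ∃ u : D.State, c ∉ u ∧ c' ∉ u ∧ s = insert c (insert c' u) :=
      ⟨(s.erase c).erase c', by simp, by simp, by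
        rw [Finset.insert_erase (Finset.mem_erase.2 ⟨hne, hc'⟩), Finset.insert_erase hc]⟩
    have a1 : (insert c (insert c' u)).erase c = insert c' u :=
      Finset.erase_insert (by rw [Finset.mem_insert]; rintro (e | e); exacts [hne e.symm, hu e])
    have a2 : (insert c (insert c' u)).erase c' = insert c u := by
      rw [Finset.insert_comm]
      exact Finset.erase_insert (by rw [Finset.mem_insert]; rintro (e | e); exacts [hne e, hu' e])
    simp only [a1, a2, Finset.erase_insert hu, Finset.erase_insert hu']
    rw [← map_add, Ideal.Quotient.eq_zero_iff_mem, koszulSign_anticomm hu hu' hne.symm]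
    have := Ideal.mul_mem_left _ (((koszulSign c' (insert c u) * koszulSign c u : ℤ) :
      D.SiteRing F) * f u) (edgePoly_comm h t hu hu' hne.symm)
    convert this using 1
    push_cast
    ring
  · rintro ⟨c, c'⟩ hp _ he
    rw [Finset.mem_sigma, Finset.mem_erase] at hp
    exact hp.2.1 (congrArg Sigma.fst he)
  · rintro ⟨c, c'⟩ hp
    rw [Finset.mem_sigma, Finset.mem_erase] at hp ⊢
    exact ⟨hp.2.2, hp.2.1.symm, hp.1⟩
  · rintro ⟨c, c'⟩ hp
    rfl

/-- The action of a permutation of the crossings and of the pieces on the cube of resolutions, where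
the vertex `s` carries the exterior product `e_s` as an additional factor. -/
noncomputable def permAct (π : Equiv.Perm (Fin D.n)) (ψ : Equiv.Perm D.Site) :
    D.PreChain F →ₗ[F] D.PreChain F where
  toFun f s := (permSign π (s.map π.symm.toEmbedding) : D.SiteRing F) *
    MvPolynomial.rename ψ (f (s.map π.symm.toEmbedding))
  map_add' f g := by
    funext s
    simp only [Pi.add_apply, map_add, mul_add]
  map_smul' a f := by
    funext s
    simp only [Pi.smul_apply, map_smul, mul_smul_comm, RingHom.id_apply]

theorem permAct_one : permAct (F := F) (1 : Equiv.Perm (Fin D.n)) (1 : Equiv.Perm D.Site) = 1 := by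
  refine LinearMap.ext fun f => ?_
  funext s
  change (permSign 1 (s.map (Equiv.refl _).toEmbedding) : D.SiteRing F) *
    MvPolynomial.rename id (f (s.map (Equiv.refl _).toEmbedding)) = f s
  rw [permSign_one, Int.cast_one, one_mul, MvPolynomial.rename_id, Equiv.refl_toEmbedding,
    Finset.map_refl]
  rfl

theorem permAct_mul (π π' : Equiv.Perm (Fin D.n)) (ψ ψ' : Equiv.Perm D.Site) :
    permAct (F := F) (π * π') (ψ * ψ') = permAct π ψ * permAct π' ψ' := by
  refine LinearMap.ext fun f => ?_
  funext s
  have e : s.map (π * π').symm.toEmbedding =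
      (s.map π.symm.toEmbedding).map π'.symm.toEmbedding := by
    rw [Finset.map_map]; rfl
  have e2 : ((s.map π.symm.toEmbedding).map π'.symm.toEmbedding).map π'.toEmbedding =
      s.map π.symm.toEmbedding := by
    rw [Finset.map_map]
    have : π'.symm.toEmbedding.trans π'.toEmbedding = Function.Embedding.refl _ := by
      ext x; simp
    rw [this, Finset.map_refl]
  change (permSign (π * π') (s.map (π * π').symm.toEmbedding) : D.SiteRing F) *
    MvPolynomial.rename (ψ ∘ ψ') (f (s.map (π * π').symm.toEmbedding)) =
    (permSign π (s.map π.symm.toEmbedding) : D.SiteRing F) * MvPolynomial.rename ψ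
    ((permSign π' ((s.map π.symm.toEmbedding).map π'.symm.toEmbedding) : D.SiteRing F) *
      MvPolynomial.rename ψ' (f ((s.map π.symm.toEmbedding).map π'.symm.toEmbedding)))
  rw [e, permSign_mul, e2, map_mul, map_intCast, MvPolynomial.rename_rename]
  push_cast
  ring

theorem permAct_pow (π : Equiv.Perm (Fin D.n)) (ψ : Equiv.Perm D.Site) (k : ℕ) :
    permAct (F := F) π ψ ^ k = permAct (π ^ k) (ψ ^ k) := by
  induction k with
  | zero => rw [pow_zero, pow_zero, pow_zero, permAct_one]
  | succ k ih => rw [pow_succ, pow_succ, pow_succ, permAct_mul, ih]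

end Ring

variable (D) in
/-- A rotational symmetry of order `m` of the diagram, whose centre does not lie on the diagram: the
permutations of the crossings, half-edges and crossingless curves by the rotation by `2π/m`. It keeps
the counterclockwise order at the crossings, the edges, and upper and lower strands; no non-trivial
power fixes a crossing or reverses an edge. It need not preserve the orientation of the link. Every
rotation of a plane diagram gives such data; they are all that the complex depends on. -/
structure Rotation (m : ℕ) where
  crossing : Equiv.Perm (Fin D.n)
  half : Equiv.Perm D.Half
  loop : Equiv.Perm (Fin D.l)
  half_fst : ∀ x, (half x).1 = crossing x.1
  half_snd : ∀ x, (half x).2 = x.2 ∨ (half x).2 = x.2 + 2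
  half_turn : ∀ x, half (turn x) = turn (half x)
  half_glue : ∀ x, half (D.glue x) = D.glue (half x)
  half_pow : half ^ m = 1
  loop_pow : loop ^ m = 1
  crossing_free : ∀ j, 0 < j → j < m → ∀ c, (crossing ^ j) c ≠ c
  edge_free : ∀ j, 0 < j → j < m → ∀ x, (half ^ j) x ≠ D.glue x

namespace Rotation

variable {m : ℕ} (σ : D.Rotation m)

/-- The permutation of all pieces. -/
def site : Equiv.Perm D.Site := Equiv.Perm.sumCongr σ.half σ.loop

theorem half_turn_symm (x : D.Half) : σ.half (turn.symm x) = turn.symm (σ.half x) := by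
  rw [Equiv.eq_symm_apply, ← σ.half_turn, Equiv.apply_symm_apply]

theorem crossing_pow : σ.crossing ^ m = 1 := by
  have h : ∀ k : ℕ, ∀ x : D.Half, ((σ.half ^ k) x).1 = (σ.crossing ^ k) x.1 := by
    intro k
    induction k with
    | zero => intro x; rfl
    | succ k ih => intro x; rw [pow_succ', pow_succ', Equiv.Perm.mul_apply, σ.half_fst, ih]; rfl
  ext1 c
  rw [← h m (c, 0), σ.half_pow]
  rfl

theorem site_pow : σ.site ^ m = 1 := by
  have h : ∀ k : ℕ, σ.site ^ k = Equiv.Perm.sumCongr (σ.half ^ k) (σ.loop ^ k) := by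
    intro k
    induction k with
    | zero => rw [pow_zero, pow_zero, pow_zero, Equiv.Perm.sumCongr_one]
    | succ k ih => rw [pow_succ, pow_succ, pow_succ, ih, site, Equiv.Perm.sumCongr_mul]
  rw [h, σ.half_pow, σ.loop_pow, Equiv.Perm.sumCongr_one]

theorem smooth_map (s : D.State) (x : D.Half) :
    D.smooth (s.map σ.crossing.toEmbedding) (σ.half x) = σ.half (D.smooth s x) := by
  have e1 : (σ.half x).1 ∈ s.map σ.crossing.toEmbedding ↔ x.1 ∈ s := by
    rw [σ.half_fst]; exact Finset.mem_map' σ.crossing.toEmbedding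
  have e2 : ((σ.half x).2 = 0 ∨ (σ.half x).2 = 2) ↔ (x.2 = 0 ∨ x.2 = 2) := by
    have : ∀ i : ZMod 4, (i + 2 = 0 ∨ i + 2 = 2) ↔ (i = 0 ∨ i = 2) := by decide
    rcases σ.half_snd x with e | e
    · rw [e]
    · rw [e, this]
  unfold smooth
  simp only [e1, e2]
  split_ifs
  · exact (σ.half_turn_symm x).symm
  · exact (σ.half_turn x).symm

theorem circle_map {s : D.State} {a b : D.Site} (h : D.circle s a = D.circle s b) :
    D.circle (s.map σ.crossing.toEmbedding) (σ.site a) =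
      D.circle (s.map σ.crossing.toEmbedding) (σ.site b) := by
  refine congrArg (Quot.lift (fun a => D.circle (s.map σ.crossing.toEmbedding) (σ.site a)) ?_) h
  rintro _ _ ⟨x, rfl, rfl | rfl⟩
  · refine (Eq.trans ?_ (circle_glue _ (σ.half x))).symm
    rw [← σ.half_glue]; rfl
  · refine (Eq.trans ?_ (circle_smooth _ (σ.half x))).symm
    rw [σ.smooth_map]; rfl

theorem circle_of_map {s : D.State} {a b : D.Site}
    (h : D.circle (s.map σ.crossing.toEmbedding) (σ.site a) =
      D.circle (s.map σ.crossing.toEmbedding) (σ.site b)) : D.circle s a = D.circle s b := by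
  suffices hJ : ∀ a b, D.Joined (s.map σ.crossing.toEmbedding) a b →
      D.circle s (σ.site.symm a) = D.circle s (σ.site.symm b) by
    have h2 : D.circle s (σ.site.symm (σ.site a)) = D.circle s (σ.site.symm (σ.site b)) :=
      congrArg (Quot.lift (fun a => D.circle s (σ.site.symm a)) hJ) h
    rwa [Equiv.symm_apply_apply, Equiv.symm_apply_apply] at h2
  rintro _ _ ⟨x, rfl, hb⟩
  obtain ⟨y, rfl⟩ := σ.half.surjective x
  rcases hb with rfl | rfl
  · rw [← σ.half_glue]
    have e1 : σ.site.symm (Sum.inl (σ.half (D.glue y))) = Sum.inl (D.glue y) :=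
      σ.site.symm_apply_apply (Sum.inl (D.glue y))
    have e2 : σ.site.symm (Sum.inl (σ.half y)) = Sum.inl y :=
      σ.site.symm_apply_apply (Sum.inl y)
    rw [e1, e2, circle_glue]
  · rw [σ.smooth_map]
    have e1 : σ.site.symm (Sum.inl (σ.half (D.smooth s y))) = Sum.inl (D.smooth s y) :=
      σ.site.symm_apply_apply (Sum.inl (D.smooth s y))
    have e2 : σ.site.symm (Sum.inl (σ.half y)) = Sum.inl y :=
      σ.site.symm_apply_apply (Sum.inl y)
    rw [e1, e2, circle_smooth]

theorem site_strand (c : Fin D.n) :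
    (σ.site (D.strand₀ c) = D.strand₀ (σ.crossing c) ∧
      σ.site (D.strand₂ c) = D.strand₂ (σ.crossing c)) ∨
    (σ.site (D.strand₀ c) = D.strand₂ (σ.crossing c) ∧
      σ.site (D.strand₂ c) = D.strand₀ (σ.crossing c)) := by
  have h2 : σ.half (c, 2) = ((σ.half (c, 0)).1, (σ.half (c, 0)).2 + 2) := by
    have e : ((c, 2) : D.Half) = turn (turn (c, 0)) := rfl
    rw [e, σ.half_turn, σ.half_turn]
    change (_, _ + 1 + 1) = _
    rw [add_assoc]; rfl
  have h1 := σ.half_fst (c, 0)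
  rcases σ.half_snd (c, 0) with h | h
  · left
    have h0 : σ.half (c, 0) = (σ.crossing c, 0) := Prod.ext h1 h
    rw [h0] at h2
    exact ⟨congrArg Sum.inl h0, congrArg Sum.inl h2⟩
  · right
    have h0 : σ.half (c, 0) = (σ.crossing c, 2) := Prod.ext h1 h
    rw [h0] at h2
    exact ⟨congrArg Sum.inl h0, congrArg Sum.inl h2⟩

variable {F : Type} [Field F]

theorem rename_edgePoly (h : F) (s : D.State) (c : Fin D.n) :
    MvPolynomial.rename σ.site (edgePoly h s c) =
      edgePoly h (s.map σ.crossing.toEmbedding) (σ.crossing c) := by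
  have hiff : D.circle s (D.strand₀ c) = D.circle s (D.strand₂ c) ↔
      D.circle (s.map σ.crossing.toEmbedding) (D.strand₀ (σ.crossing c)) =
        D.circle (s.map σ.crossing.toEmbedding) (D.strand₂ (σ.crossing c)) := by
    have : D.circle s (D.strand₀ c) = D.circle s (D.strand₂ c) ↔ _ :=
      ⟨σ.circle_map, σ.circle_of_map⟩
    rcases σ.site_strand c with ⟨e1, e2⟩ | ⟨e1, e2⟩
    · rw [this, e1, e2]
    · rw [this, e1, e2, eq_comm]
  unfold edgePoly
  by_cases hm : D.circle s (D.strand₀ c) = D.circle s (D.strand₂ c)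
  · rw [if_pos hm, if_pos (hiff.1 hm)]
    simp only [map_add, map_sub, MvPolynomial.rename_X, MvPolynomial.rename_C]
    rcases σ.site_strand c with ⟨e1, e2⟩ | ⟨e1, e2⟩
    · rw [e1, e2]
    · rw [e1, e2, add_comm]
  · rw [if_neg hm, if_neg (fun e => hm (hiff.2 e)), map_one]

theorem rename_mem (h t : F) {s : D.State} {p : D.SiteRing F} (hp : p ∈ stateIdeal h t s) :
    MvPolynomial.rename σ.site p ∈ stateIdeal h t (s.map σ.crossing.toEmbedding) := by
  suffices H : stateIdeal h t s ≤ Ideal.comap (MvPolynomial.rename σ.site)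
      (stateIdeal h t (s.map σ.crossing.toEmbedding)) from H hp
  apply Ideal.span_le.2
  rintro q (⟨a, rfl⟩ | ⟨a, b, hab, rfl⟩)
  · change MvPolynomial.rename σ.site (MvPolynomial.X a ^ 2 - MvPolynomial.C h * MvPolynomial.X a
      - MvPolynomial.C t) ∈ stateIdeal h t _
    simp only [map_sub, map_mul, map_pow, MvPolynomial.rename_X, MvPolynomial.rename_C]
    exact quad_mem h t _ _
  · change MvPolynomial.rename σ.site (MvPolynomial.X a - MvPolynomial.X b) ∈ stateIdeal h t _
    simp only [map_sub, MvPolynomial.rename_X]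
    exact sub_mem_of_circle_eq h t (σ.circle_map hab)

theorem map_symm_map (s : D.State) :
    (s.map σ.crossing.symm.toEmbedding).map σ.crossing.toEmbedding = s := by
  rw [Finset.map_map]
  have : σ.crossing.symm.toEmbedding.trans σ.crossing.toEmbedding = Function.Embedding.refl _ := by
    ext x; simp
  rw [this, Finset.map_refl]

theorem permAct_mem (h t : F) {f : D.PreChain F} (hf : f ∈ stateRel h t) :
    permAct σ.crossing σ.site f ∈ stateRel h t := by
  intro s
  apply Ideal.mul_mem_left
  have := σ.rename_mem h t (hf (s.map σ.crossing.symm.toEmbedding))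
  rwa [σ.map_symm_map] at this

theorem permAct_preDiff (h : F) (f : D.PreChain F) :
    permAct σ.crossing σ.site (preDiff h f) = preDiff h (permAct σ.crossing σ.site f) := by
  funext s
  obtain ⟨u, rfl⟩ : ∃ u : D.State, s = u.map σ.crossing.toEmbedding :=
    ⟨_, (σ.map_symm_map s).symm⟩
  have hu : ∀ v : D.State,
      (v.map σ.crossing.toEmbedding).map σ.crossing.symm.toEmbedding = v := by
    intro v
    rw [Finset.map_map]
    have : σ.crossing.toEmbedding.trans σ.crossing.symm.toEmbedding =
        Function.Embedding.refl _ := by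
      ext x; simp
    rw [this, Finset.map_refl]
  change (permSign σ.crossing ((u.map _).map _) : D.SiteRing F) *
    MvPolynomial.rename σ.site (preDiff h f ((u.map _).map _)) = ∑ c ∈ u.map _, _
  rw [hu, Finset.sum_map]
  change _ * MvPolynomial.rename σ.site (∑ c ∈ u, _) = _
  rw [map_sum, Finset.mul_sum]
  apply Finset.sum_congr rfl
  intro c hc
  have he : (u.map σ.crossing.toEmbedding).erase (σ.crossing.toEmbedding c) =
      (u.erase c).map σ.crossing.toEmbedding := (Finset.map_erase _ _ _).symm
  rw [he]
  change _ = _ * (_ * ((permSign σ.crossing (((u.erase c).map _).map _) : D.SiteRing F) *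
    MvPolynomial.rename σ.site (f (((u.erase c).map _).map _))))
  rw [hu, map_mul, map_mul, map_intCast, σ.rename_edgePoly]
  have hs := permSign_insert σ.crossing (Finset.notMem_erase c u)
  rw [Finset.insert_erase hc] at hs
  have hs' : (permSign σ.crossing u : D.SiteRing F) * (koszulSign c (u.erase c) : D.SiteRing F) =
      (koszulSign (σ.crossing c) ((u.erase c).map σ.crossing.toEmbedding) : D.SiteRing F) *
        (permSign σ.crossing (u.erase c) : D.SiteRing F) := by
    exact_mod_cast congrArg (Int.cast : ℤ → D.SiteRing F) hs
  rw [← mul_assoc, hs']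
  change _ = (koszulSign (σ.crossing c) _ : D.SiteRing F) *
    (edgePoly h _ (σ.crossing c) * _)
  ring

end Rotation

section Grading

variable {F : Type} [Field F]

variable (D) in
/-- The number of positive crossings. -/
def nPlus : ℕ := (Finset.univ.filter fun c : Fin D.n => D.out (c, 0) ≠ D.out (c, 1)).card

variable (D) in
/-- The number of negative crossings. -/
def nMinus : ℕ := (Finset.univ.filter fun c : Fin D.n => D.out (c, 0) = D.out (c, 1)).card

variable (D) in
/-- The homological degree of the vertex `s` of the cube. -/
def homDegree (s : D.State) : ℤ := s.card - D.nMinus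

variable (D) in
/-- The quantum degree of the monomial `u` at the vertex `s`, where `1` has degree `1` and `X` has
degree `-1` in `A`. -/
noncomputable def qDegree (s : D.State) (u : D.Site →₀ ℕ) : ℤ :=
  Nat.card (D.Circle s) - 2 * u.degree + s.card + D.nPlus - 2 * D.nMinus

variable (D F) in
/-- Chains in homological degree `i`. -/
def preDegree (i : ℤ) : Submodule F (D.PreChain F) where
  carrier := {f | ∀ s, f s ≠ 0 → D.homDegree s = i}
  add_mem' {f g} hf hg s hs := by
    by_cases h : f s = 0
    · exact hg s fun h' => hs (by rw [Pi.add_apply, h, h', add_zero])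
    · exact hf s h
  zero_mem' s hs := (hs rfl).elim
  smul_mem' a f hf s hs := hf s fun h => hs (by rw [Pi.smul_apply, h, smul_zero])

variable (D F) in
/-- Chains of quantum degree at least `k`. -/
def preFiltration (k : ℤ) : Submodule F (D.PreChain F) where
  carrier := {f | ∀ s u, (f s).coeff u ≠ 0 → k ≤ D.qDegree s u}
  add_mem' {f g} hf hg s u hs := by
    by_cases h : (f s).coeff u = 0
    · exact hg s u fun h' => hs (by rw [Pi.add_apply, MvPolynomial.coeff_add, h, h', add_zero])
    · exact hf s u h
  zero_mem' s u hs := (hs (MvPolynomial.coeff_zero u)).elim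
  smul_mem' a f hf s u hs :=
    hf s u fun h => hs (by rw [Pi.smul_apply, MvPolynomial.coeff_smul, h, smul_zero])

theorem preDiff_mem_preDegree (h : F) {i : ℤ} {f : D.PreChain F} (hf : f ∈ D.preDegree F i) :
    preDiff h f ∈ D.preDegree F (i + 1) := by
  intro s hs
  obtain ⟨c, hc, hne⟩ := Finset.exists_ne_zero_of_sum_ne_zero hs
  have h1 : f (s.erase c) ≠ 0 := fun e => hne (by rw [e, mul_zero, mul_zero])
  have h2 := hf _ h1
  unfold homDegree at h2 ⊢
  have h3 := Finset.card_erase_add_one hc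
  omega

theorem card_circle_of_merge {s t : D.State} {c : Fin D.n}
    (hst : ∀ x : D.Half, x.1 ≠ c → D.smooth t x = D.smooth s x)
    (hs : D.circle s (D.strand₀ c) ≠ D.circle s (D.strand₂ c))
    (ht : D.circle t (D.strand₀ c) = D.circle t (D.strand₂ c)) :
    Nat.card (D.Circle s) = Nat.card (D.Circle t) + 1 := by
  classical
  have up : ∀ a b, D.circle s a = D.circle s b → D.circle t a = D.circle t b := by
    intro a b hab
    rcases circle_transfer hst hab with h | ⟨h, h'⟩ | ⟨h, h'⟩
    · exact h
    · rw [h, h', ht]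
    · rw [h, h', ht]
  have down := fun {a b} (hab : D.circle t a = D.circle t b) =>
    circle_transfer (fun x hx => (hst x hx).symm) hab
  rw [← Finite.card_option]
  let f : D.Circle s → Option (D.Circle t) := fun q =>
    if q = D.circle s (D.strand₂ c) then none
    else some (Quot.lift (D.circle t) (fun a b hab => up a b (Quot.sound hab)) q)
  have hf : ∀ a, f (D.circle s a) =
      if D.circle s a = D.circle s (D.strand₂ c) then none else some (D.circle t a) :=
    fun a => rfl
  refine Nat.card_eq_of_bijective f ⟨?_, ?_⟩
  · intro p q
    induction p using Quot.ind with | mk a =>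
    induction q using Quot.ind with | mk b =>
    change f (D.circle s a) = f (D.circle s b) → D.circle s a = D.circle s b
    rw [hf, hf]
    split_ifs with h1 h2 h2
    · intro _; exact h1.trans h2.symm
    · intro h; exact absurd h (by simp)
    · intro h; exact absurd h (by simp)
    · intro h
      rcases down (Option.some.inj h) with h3 | ⟨h3, h4⟩ | ⟨h3, h4⟩
      · exact h3
      · exact absurd h4 h2
      · exact absurd h3 h1
  · rintro (_ | q)
    · exact ⟨D.circle s (D.strand₂ c), by rw [hf, if_pos rfl]⟩
    · induction q using Quot.ind with | mk a =>
      by_cases h : D.circle s a = D.circle s (D.strand₂ c)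
      · refine ⟨D.circle s (D.strand₀ c), ?_⟩
        rw [hf, if_neg hs, ht, ← up _ _ h]; rfl
      · exact ⟨D.circle s a, by rw [hf, if_neg h]; rfl⟩

theorem coeff_X_mul_bound {B : ℤ} {p : D.SiteRing F}
    (hp : ∀ u, p.coeff u ≠ 0 → 2 * (u.degree : ℤ) ≤ B) (a : D.Site) (u : D.Site →₀ ℕ)
    (hu : (MvPolynomial.X a * p).coeff u ≠ 0) : 2 * (u.degree : ℤ) ≤ B + 2 := by
  classical
  rw [MvPolynomial.coeff_X_mul'] at hu
  split_ifs at hu with h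
  · have h1 := hp _ hu
    have h2 : u - Finsupp.single a 1 + Finsupp.single a 1 = u := by
      apply tsub_add_cancel_of_le
      rw [Finsupp.single_le_iff]
      exact Nat.one_le_iff_ne_zero.2 (Finsupp.mem_support_iff.1 h)
    have h3 := congrArg Finsupp.degree h2
    rw [map_add, Finsupp.degree_single] at h3
    omega
  · exact (hu rfl).elim

theorem preDiff_mem_preFiltration (h : F) {k : ℤ} {f : D.PreChain F}
    (hf : f ∈ D.preFiltration F k) : preDiff h f ∈ D.preFiltration F k := by
  intro s
  change ∀ u, (∑ c ∈ s, (koszulSign c (s.erase c) : D.SiteRing F) *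
    (edgePoly h (s.erase c) c * f (s.erase c))).coeff u ≠ 0 → _
  intro u hu
  rw [MvPolynomial.coeff_sum] at hu
  obtain ⟨c, hc, hne⟩ := Finset.exists_ne_zero_of_sum_ne_zero hu
  have hne' : (edgePoly h (s.erase c) c * f (s.erase c)).coeff u ≠ 0 := by
    intro e
    apply hne
    have : ((koszulSign c (s.erase c) : ℤ) : D.SiteRing F) =
        MvPolynomial.C ((koszulSign c (s.erase c) : ℤ) : F) := by simp
    rw [this, MvPolynomial.coeff_C_mul, e, mul_zero]
  clear hne hu
  have hcard := Finset.card_erase_add_one hc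
  have hbound := hf (s.erase c)
  have hc' := Finset.notMem_erase c s
  have hiff := circle_insert_iff hc'
  rw [Finset.insert_erase hc] at hiff
  have hsm : ∀ x : D.Half, x.1 ≠ c → D.smooth s x = D.smooth (s.erase c) x := by
    intro x hx
    have := smooth_insert_ne (s := s.erase c) hx
    rwa [Finset.insert_erase hc] at this
  unfold qDegree at hbound ⊢
  unfold edgePoly at hne'
  split_ifs at hne' with hm
  · have hcirc := card_circle_of_merge (fun x hx => (hsm x hx).symm) (hiff.1 hm) hm
    have hB : ∀ u, (f (s.erase c)).coeff u ≠ 0 → 2 * (u.degree : ℤ) ≤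
        Nat.card (D.Circle (s.erase c)) + (s.erase c).card + D.nPlus - 2 * D.nMinus - k := by
      intro u hu
      have := hbound u hu
      omega
    rw [sub_mul, add_mul, MvPolynomial.coeff_sub, MvPolynomial.coeff_add,
      MvPolynomial.coeff_C_mul] at hne'
    by_cases h1 : (MvPolynomial.X (D.strand₀ c) * f (s.erase c)).coeff u = 0
    · by_cases h2 : (MvPolynomial.X (D.strand₂ c) * f (s.erase c)).coeff u = 0
      · rw [h1, h2, add_zero, zero_sub, neg_ne_zero] at hne'
        have := hB u (right_ne_zero_of_mul hne')
        omega
      · have := coeff_X_mul_bound hB _ u h2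
        omega
    · have := coeff_X_mul_bound hB _ u h1
      omega
  · rw [one_mul] at hne'
    have ht : D.circle s (D.strand₀ c) = D.circle s (D.strand₂ c) := by
      by_contra e; exact hm (hiff.2 e)
    have hcirc := card_circle_of_merge hsm hm ht
    have := hbound u hne'
    omega

theorem Rotation.permAct_mem_preDegree {m : ℕ} (σ : D.Rotation m) {i : ℤ} {f : D.PreChain F}
    (hf : f ∈ D.preDegree F i) : permAct σ.crossing σ.site f ∈ D.preDegree F i := by
  intro s hs
  have h1 : f (s.map σ.crossing.symm.toEmbedding) ≠ 0 := fun e => hs (by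
    change _ * MvPolynomial.rename σ.site (f (s.map σ.crossing.symm.toEmbedding)) = 0
    rw [e, map_zero, mul_zero])
  have h2 := hf _ h1
  unfold homDegree at h2 ⊢
  rwa [Finset.card_map] at h2

theorem Rotation.card_circle {m : ℕ} (σ : D.Rotation m) (s : D.State) :
    Nat.card (D.Circle (s.map σ.crossing.toEmbedding)) = Nat.card (D.Circle s) := by
  symm
  refine Nat.card_eq_of_bijective (Quot.lift
    (fun a => D.circle (s.map σ.crossing.toEmbedding) (σ.site a))
    fun a b h => σ.circle_map (Quot.sound h)) ⟨?_, ?_⟩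
  · intro p q
    induction p using Quot.ind with | mk a =>
    induction q using Quot.ind with | mk b =>
    intro h
    exact σ.circle_of_map h
  · intro q
    induction q using Quot.ind with | mk a =>
    exact ⟨D.circle s (σ.site.symm a), congrArg (D.circle _) (σ.site.apply_symm_apply a)⟩

theorem Rotation.permAct_mem_preFiltration {m : ℕ} (σ : D.Rotation m) {k : ℤ}
    {f : D.PreChain F} (hf : f ∈ D.preFiltration F k) :
    permAct σ.crossing σ.site f ∈ D.preFiltration F k := by
  intro s u hu
  have hne : (MvPolynomial.rename σ.site (f (s.map σ.crossing.symm.toEmbedding))).coeff u ≠ 0 := by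
    intro e
    apply hu
    change (_ * MvPolynomial.rename σ.site (f (s.map σ.crossing.symm.toEmbedding))).coeff u = 0
    have : ((permSign σ.crossing (s.map σ.crossing.symm.toEmbedding) : ℤ) : D.SiteRing F) =
        MvPolynomial.C ((permSign σ.crossing (s.map σ.crossing.symm.toEmbedding) : ℤ) : F) := by
      simp
    rw [this, MvPolynomial.coeff_C_mul, e, mul_zero]
  obtain ⟨v, rfl, hv⟩ := MvPolynomial.coeff_rename_ne_zero _ _ _ hne
  have h1 := hf _ v hv
  have h2 := σ.card_circle (s.map σ.crossing.symm.toEmbedding)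
  rw [σ.map_symm_map] at h2
  unfold qDegree at h1 ⊢
  rw [Finset.card_map, ← h2] at h1
  have h3 : (v.mapDomain σ.site).degree = v.degree := by
    exact Finsupp.degree_mapDomain _ _
  rw [h3]
  exact h1

/-- The action of the rotation on the cube of resolutions. The vertex `s` carries the exterior product
`e_s`, and the shift of the homological degree by the number of negative crossings is the tensor
product with the dual of their exterior product. This is the sign in front: a rotation that
preserves the orientation permutes them in `nMinus / m` cycles of length `m`. It is `1` if `m` is
odd. -/
noncomputable def Rotation.act {m : ℕ} (σ : D.Rotation m) : D.PreChain F →ₗ[F] D.PreChain F :=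
  (-1 : F) ^ ((m - 1) * (D.nMinus / m)) • permAct σ.crossing σ.site

theorem Rotation.act_pow {m : ℕ} (σ : D.Rotation m) : (σ.act (F := F)) ^ m = 1 := by
  unfold Rotation.act
  rw [smul_pow, permAct_pow, σ.crossing_pow, σ.site_pow, permAct_one, ← pow_mul]
  have h : Even ((m - 1) * (D.nMinus / m) * m) := by
    have := Nat.even_mul_pred_self m
    rw [show (m - 1) * (D.nMinus / m) * m = m * (m - 1) * (D.nMinus / m) by ring]
    exact this.mul_right _
  rw [h.neg_one_pow, one_smul]

theorem Rotation.act_preDiff {m : ℕ} (σ : D.Rotation m) (h : F) (f : D.PreChain F) :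
    σ.act (preDiff h f) = preDiff h (σ.act f) := by
  unfold Rotation.act
  rw [LinearMap.smul_apply, LinearMap.smul_apply, map_smul, σ.permAct_preDiff]

end Grading

end LinkDiagram

/-- The homomorphism from the cyclic group of order `m` that maps the generator to `x`. -/
def zmodHom {N : Type} [Monoid N] (m : ℕ) [NeZero m] (x : N) (hx : x ^ m = 1) :
    Multiplicative (ZMod m) →* N where
  toFun g := x ^ g.toAdd.val
  map_one' := by simp
  map_mul' a b := by
    rw [toAdd_mul, ZMod.val_add, ← pow_add]
    exact (pow_eq_pow_mod _ hx).symm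

/-- The group algebra `Λ_m` of the cyclic group of order `m` over `F`. -/
abbrev CyclicGroupRing (F : Type) [Field F] (m : ℕ) : Type :=
  MonoidAlgebra F (Multiplicative (ZMod m))

/-- A cochain complex of `Λ`-modules with a decreasing filtration by subcomplexes; `X` is the direct
sum of the terms `deg i` of the complex. -/
structure FilteredComplex (Λ : Type) [CommRing Λ] where
  X : Type
  [addCommGroup : AddCommGroup X]
  [module : Module Λ X]
  d : X →ₗ[Λ] X
  d_d : ∀ x, d (d x) = 0
  deg : ℤ → Submodule Λ X
  deg_isInternal : DirectSum.IsInternal deg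
  d_mem_deg : ∀ i, ∀ x ∈ deg i, d x ∈ deg (i + 1)
  filtration : ℤ → Submodule Λ X
  filtration_anti : Antitone filtration
  d_mem_filtration : ∀ k, ∀ x ∈ filtration k, d x ∈ filtration k

attribute [instance] FilteredComplex.addCommGroup FilteredComplex.module

namespace LinkDiagram

section Chain

variable {F : Type} [Field F] (h t : F) {D : LinkDiagram} {m : ℕ} (σ : D.Rotation m)

/-- The Khovanov-like chain complex of the diagram, as a vector space: the direct sum of the spaces
`A^{⊗ circles of s}`. -/
def Chain (_h _t : F) (_σ : D.Rotation m) : Type := D.PreChain F ⧸ stateRel (D := D) _h _t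

noncomputable instance : AddCommGroup (Chain h t σ) :=
  inferInstanceAs (AddCommGroup (D.PreChain F ⧸ stateRel (D := D) h t))

noncomputable instance : Module F (Chain h t σ) :=
  inferInstanceAs (Module F (D.PreChain F ⧸ stateRel (D := D) h t))

/-- The class of a family of polynomials. -/
noncomputable def Chain.mk : D.PreChain F →ₗ[F] Chain h t σ := (stateRel h t).mkQ

/-- The map induced on classes. -/
noncomputable def Chain.map (φ : D.PreChain F →ₗ[F] D.PreChain F)
    (hφ : ∀ f ∈ stateRel h t, φ f ∈ stateRel h t) : Chain h t σ →ₗ[F] Chain h t σ :=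
  (stateRel h t).mapQ (stateRel h t) φ hφ

theorem Chain.map_mk (φ : D.PreChain F →ₗ[F] D.PreChain F)
    (hφ : ∀ f ∈ stateRel h t, φ f ∈ stateRel h t) (f : D.PreChain F) :
    Chain.map h t σ φ hφ (Chain.mk h t σ f) = Chain.mk h t σ (φ f) := rfl

theorem Chain.mk_surjective : Function.Surjective (Chain.mk h t σ) :=
  Submodule.mkQ_surjective _

theorem Chain.mk_eq_zero {f : D.PreChain F} : Chain.mk h t σ f = 0 ↔ f ∈ stateRel h t :=
  Submodule.Quotient.mk_eq_zero _

/-- The action of the rotation on the chain complex. -/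
noncomputable def rot : Module.End F (Chain h t σ) :=
  Chain.map h t σ σ.act fun _ hf => Submodule.smul_mem _ _ (σ.permAct_mem h t hf)

theorem rot_pow : rot h t σ ^ m = 1 := by
  have key : ∀ k : ℕ, ∀ f, (rot h t σ ^ k) (Chain.mk h t σ f) =
      Chain.mk h t σ ((σ.act ^ k) f) := by
    intro k
    induction k with
    | zero => intro f; rfl
    | succ k ih =>
      intro f
      rw [pow_succ', pow_succ', Module.End.mul_apply, ih]
      rfl
  refine LinearMap.ext fun x => ?_
  obtain ⟨f, rfl⟩ := Chain.mk_surjective h t σ x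
  rw [key, σ.act_pow]
  rfl

variable [NeZero m]

/-- The action of the cyclic group on the chain complex. -/
noncomputable def rotRep : Representation F (Multiplicative (ZMod m)) (Chain h t σ) :=
  zmodHom m (rot h t σ) (rot_pow h t σ)

noncomputable instance : Module (CyclicGroupRing F m) (Chain h t σ) :=
  Module.compHom _ (rotRep h t σ).asAlgebraHom.toRingHom

theorem Chain.smul_eq (a : CyclicGroupRing F m) (x : Chain h t σ) :
    a • x = a.coeff.sum fun g b => b • (rot h t σ ^ g.toAdd.val) x := by
  change (rotRep h t σ).asAlgebraHom a x = _
  rw [Representation.asAlgebraHom_def, MonoidAlgebra.lift_apply, Finsupp.sum,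
    LinearMap.sum_apply]
  rfl

theorem Chain.smul_mem {S : Submodule F (Chain h t σ)} (hS : ∀ x ∈ S, rot h t σ x ∈ S)
    (a : CyclicGroupRing F m) {x : Chain h t σ} (hx : x ∈ S) : a • x ∈ S := by
  rw [Chain.smul_eq]
  refine S.sum_mem fun g _ => S.smul_mem _ ?_
  generalize g.toAdd.val = k
  induction k with
  | zero => exact hx
  | succ k ih => rw [pow_succ']; exact hS _ ih

/-- A subspace that is stable under the rotation is a `Λ_m`-submodule. -/
def Chain.submodule (S : Submodule F (Chain h t σ)) (hS : ∀ x ∈ S, rot h t σ x ∈ S) :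
    Submodule (CyclicGroupRing F m) (Chain h t σ) where
  toAddSubmonoid := S.toAddSubmonoid
  smul_mem' a _ hx := Chain.smul_mem h t σ hS a hx

/-- A linear map that commutes with the rotation is `Λ_m`-linear. -/
noncomputable def Chain.linearMap (φ : Chain h t σ →ₗ[F] Chain h t σ)
    (hφ : ∀ x, φ (rot h t σ x) = rot h t σ (φ x)) :
    Chain h t σ →ₗ[CyclicGroupRing F m] Chain h t σ where
  toFun := φ
  map_add' := φ.map_add
  map_smul' a x := by
    rw [Chain.smul_eq, RingHom.id_apply, Chain.smul_eq, Finsupp.sum, map_sum, Finsupp.sum]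
    refine Finset.sum_congr rfl fun g _ => ?_
    rw [map_smul]
    congr 1
    generalize g.toAdd.val = k
    induction k with
    | zero => rfl
    | succ k ih => rw [pow_succ', Module.End.mul_apply, hφ, ih]; rfl

/-- The differential. -/
noncomputable def diff : Chain h t σ →ₗ[CyclicGroupRing F m] Chain h t σ :=
  Chain.linearMap h t σ (Chain.map h t σ (preDiff h) fun _ hf => preDiff_mem h t hf) fun x => by
    obtain ⟨f, rfl⟩ := Chain.mk_surjective h t σ x
    exact congrArg (Chain.mk h t σ) (σ.act_preDiff h f).symm

/-- The term of homological degree `i`. -/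
noncomputable def degree (i : ℤ) : Submodule (CyclicGroupRing F m) (Chain h t σ) :=
  Chain.submodule h t σ ((D.preDegree F i).map (Chain.mk h t σ)) (by
    rintro _ ⟨f, hf, rfl⟩
    exact ⟨_, Submodule.smul_mem _ _ (σ.permAct_mem_preDegree hf), rfl⟩)

/-- The quantum filtration. -/
noncomputable def qFiltration (k : ℤ) : Submodule (CyclicGroupRing F m) (Chain h t σ) :=
  Chain.submodule h t σ ((D.preFiltration F k).map (Chain.mk h t σ)) (by
    rintro _ ⟨f, hf, rfl⟩
    exact ⟨_, Submodule.smul_mem _ _ (σ.permAct_mem_preFiltration hf), rfl⟩)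

theorem degree_isInternal : DirectSum.IsInternal (degree h t σ) := by
  classical
  let pr : ℤ → D.PreChain F →ₗ[F] D.PreChain F := fun i =>
    { toFun := fun f s => if D.homDegree s = i then f s else 0
      map_add' := fun f g => by
        funext s; by_cases hs : D.homDegree s = i <;> simp [hs]
      map_smul' := fun a f => by
        funext s; by_cases hs : D.homDegree s = i <;> simp [hs] }
  have hprmem : ∀ i f, f ∈ stateRel h t → pr i f ∈ stateRel h t := by
    intro i f hf s
    change (if D.homDegree s = i then f s else 0) ∈ _
    split_ifs
    · exact hf s
    · exact Ideal.zero_mem _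
  have hsame : ∀ i f, f ∈ D.preDegree F i → pr i f = f := by
    intro i f hf
    funext s
    change (if D.homDegree s = i then f s else 0) = f s
    split_ifs with hs
    · rfl
    · by_contra h0; exact hs (hf s fun e => h0 e.symm)
  have hother : ∀ i j f, i ≠ j → f ∈ D.preDegree F j → pr i f = 0 := by
    intro i j f hij hf
    funext s
    change (if D.homDegree s = i then f s else 0) = 0
    split_ifs with hs
    · by_contra h0; exact hij (hs.symm.trans (hf s h0))
    · rfl
  rw [DirectSum.isInternal_submodule_iff_iSupIndep_and_iSup_eq_top]
  constructor
  · intro i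
    rw [disjoint_iff, eq_bot_iff]
    rintro x ⟨⟨f, hf, rfl⟩, hx⟩
    let Pi := Chain.map h t σ (pr i) (hprmem i)
    have hPi : ∀ y ∈ ⨆ j, ⨆ (_ : j ≠ i), degree h t σ j, Pi y = 0 := by
      intro y hy
      induction hy using Submodule.iSup_induction' with
      | mem j y hy =>
        by_cases hj : j = i
        · subst hj
          simp only [ne_eq, not_true_eq_false, iSup_false, Submodule.mem_bot] at hy
          rw [hy, map_zero]
        · simp only [ne_eq, hj, not_false_eq_true, iSup_pos] at hy
          obtain ⟨g, hg, rfl⟩ := hy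
          change Chain.mk h t σ (pr i g) = 0
          rw [hother i j g (fun e => hj e.symm) hg, map_zero]
      | zero => exact map_zero _
      | add y z _ _ hy hz => rw [map_add, hy, hz, add_zero]
    have h1 := hPi _ hx
    have h2 : Pi (Chain.mk h t σ f) = Chain.mk h t σ f :=
      congrArg (Chain.mk h t σ) (hsame i f hf)
    rw [h2] at h1
    exact h1
  · rw [eq_top_iff]
    intro x _
    obtain ⟨f, rfl⟩ := Chain.mk_surjective h t σ x
    have hf : f = ∑ s, Pi.single s (f s) := (Finset.univ_sum_single f).symm
    rw [hf, map_sum]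
    refine Submodule.sum_mem _ fun s _ => ?_
    refine Submodule.mem_iSup_of_mem (D.homDegree s) ⟨_, ?_, rfl⟩
    intro s' hs'
    by_cases e : s' = s
    · rw [e]
    · exact (hs' (Pi.single_eq_of_ne e _)).elim

/-- The Khovanov-like complex of the diagram for the Frobenius system given by `h` and `t`, as a
filtered complex of `Λ_m`-modules. `h = t = 0` is Khovanov homology, `h = 0`, `t = 1` is Lee homology,
and `h = 1`, `t = 0` over `𝔽₂` is filtered Bar-Natan homology. -/
noncomputable def khComplex :
    FilteredComplex (CyclicGroupRing F m) where
  X := Chain h t σ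
  d := diff h t σ
  d_d x := by
    obtain ⟨f, rfl⟩ := Chain.mk_surjective h t σ x
    exact (Chain.mk_eq_zero h t σ).2 (preDiff_preDiff_mem h t f)
  deg := degree h t σ
  deg_isInternal := degree_isInternal h t σ
  d_mem_deg i := by
    rintro _ ⟨f, hf, rfl⟩
    exact ⟨_, preDiff_mem_preDegree h hf, rfl⟩
  filtration := qFiltration h t σ
  filtration_anti := by
    rintro k k' hk _ ⟨f, hf, rfl⟩
    exact ⟨f, fun s u hu => hk.trans (hf s u hu), rfl⟩
  d_mem_filtration k := by
    rintro _ ⟨f, hf, rfl⟩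
    exact ⟨_, preDiff_mem_preFiltration h hf, rfl⟩

end Chain

end LinkDiagram

open CategoryTheory

section Ext

variable {Λ : Type} [CommRing Λ] {M : ModuleCat.{0} Λ} (P : ProjectiveResolution M)
  (K : FilteredComplex Λ)

/-- Cochains of the total complex of the double complex `Hom_Λ(P_a, K^b)`, in all degrees. -/
abbrev ExtCochain : Type := (a : ℕ) → P.complex.X a →ₗ[Λ] K.X

/-- The total differential. -/
def ExtCochain.d : ExtCochain P K →ₗ[Λ] ExtCochain P K where
  toFun f
    | 0 => K.d ∘ₗ f 0
    | a + 1 => (-1 : Λ) ^ (a + 1) • K.d ∘ₗ f (a + 1) + f a ∘ₗ (P.complex.d (a + 1) a).hom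
  map_add' f g := by
    funext a
    cases a with
    | zero => exact LinearMap.comp_add _ _ _
    | succ a =>
      simp only [Pi.add_apply, LinearMap.comp_add, LinearMap.add_comp, smul_add]
      abel
  map_smul' c f := by
    funext a
    cases a with
    | zero => exact LinearMap.comp_smul _ _ _
    | succ a =>
      simp only [Pi.smul_apply, LinearMap.comp_smul, LinearMap.smul_comp, smul_add,
        RingHom.id_apply]
      rw [smul_comm]

/-- Cochains of total degree `i`: the component on `P_a` takes values in `K^{i - a}`. -/
def ExtCochain.degree (i : ℤ) : Submodule Λ (ExtCochain P K) where
  carrier := {f | ∀ (a : ℕ) (x), f a x ∈ K.deg (i - a)}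
  add_mem' hf hg a x := add_mem (hf a x) (hg a x)
  zero_mem' _ _ := zero_mem _
  smul_mem' c _ hf a x := Submodule.smul_mem _ c (hf a x)

/-- The filtration induced by the filtration of `K`. -/
def ExtCochain.filtration (k : ℤ) : Submodule Λ (ExtCochain P K) where
  carrier := {f | ∀ a x, f a x ∈ K.filtration k}
  add_mem' hf hg a x := add_mem (hf a x) (hg a x)
  zero_mem' _ _ := zero_mem _
  smul_mem' c _ hf a x := Submodule.smul_mem _ c (hf a x)

/-- Cocycles of degree `i`. -/
def extCocycles (i : ℤ) : Submodule Λ (ExtCochain P K) :=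
  LinearMap.ker (ExtCochain.d P K) ⊓ ExtCochain.degree P K i

/-- Coboundaries of degree `i`. -/
def extCoboundaries (i : ℤ) : Submodule Λ (ExtCochain P K) :=
  (ExtCochain.degree P K (i - 1)).map (ExtCochain.d P K)

/-- `Ext^i_Λ(M; K)`, computed from the projective resolution `P` of `M`. -/
abbrev HyperExt (i : ℤ) : Type :=
  extCocycles P K i ⧸ (extCoboundaries P K i).submoduleOf (extCocycles P K i)

/-- The induced filtration of `Ext^i_Λ(M; K)`: classes of cocycles that lie in the `k`-th step. -/
def HyperExt.filtration (i k : ℤ) : Submodule Λ (HyperExt P K i) :=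
  ((ExtCochain.filtration P K k).submoduleOf (extCocycles P K i)).map (Submodule.mkQ _)

/-- The graded pieces of that filtration. -/
abbrev HyperExt.Gr (i k : ℤ) : Type :=
  HyperExt.filtration P K i k ⧸
    (HyperExt.filtration P K i (k + 1)).submoduleOf (HyperExt.filtration P K i k)

end Ext

section CyclicModules

open Polynomial

variable {F : Type} [Field F] {m : ℕ}

theorem root_pow_eq_one {f : F[X]} (hf : f ∣ X ^ m - 1) : AdjoinRoot.root f ^ m = 1 := by
  have : AdjoinRoot.mk f (X ^ m - 1) = 0 := AdjoinRoot.mk_eq_zero.2 hf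
  rwa [map_sub, map_pow, AdjoinRoot.mk_X, map_one, sub_eq_zero] at this

variable [NeZero m]

/-- The homomorphism from `Λ_m` to `F[X] / (f)` that maps the generator to `X`. -/
noncomputable def generatorHom (f : F[X]) (hf : f ∣ X ^ m - 1) :
    CyclicGroupRing F m →ₐ[F] AdjoinRoot f :=
  MonoidAlgebra.lift F (AdjoinRoot f) (Multiplicative (ZMod m))
    (zmodHom m (AdjoinRoot.root f) (root_pow_eq_one hf))

/-- The `Λ_m`-module `F[X] / (f)`, for `f` a divisor of `X^m - 1`, where the generator acts as
multiplication by `X`. -/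
noncomputable def cyclicModule (f : F[X]) (hf : f ∣ X ^ m - 1) :
    ModuleCat.{0} (CyclicGroupRing F m) :=
  (ModuleCat.restrictScalars (generatorHom f hf).toRingHom).obj
    (ModuleCat.of (AdjoinRoot f) (AdjoinRoot f))

theorem cyclotomic_dvd (F : Type) [Field F] {d m : ℕ} (hd : d ∣ m) :
    cyclotomic d F ∣ X ^ m - 1 := by
  refine (cyclotomic.dvd_X_pow_sub_one d F).trans ?_
  obtain ⟨e, rfl⟩ := hd
  rw [pow_mul]
  simpa using sub_dvd_pow_sub_pow (X ^ d : F[X]) 1 e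

open scoped Classical in
/-- The cyclotomic coset mod `r` of `a` in `ℤ/m`. -/
noncomputable def cyclotomicCoset (m r : ℕ) [NeZero m] (a : ZMod m) : Finset (ZMod m) :=
  Finset.univ.filter fun b => ∃ k : ℕ, a * (r : ZMod m) ^ k = b

variable {r : ℕ} [Fact r.Prime] {K : Type} [Field K] [Algebra (ZMod r) K] {ξ : K}

theorem exists_cosetPoly (hr : IsUnit (m : ZMod r)) (hξ : IsPrimitiveRoot ξ m) (a : ZMod m) :
    ∃ f : (ZMod r)[X], f.map (algebraMap (ZMod r) K) =
      ∏ u ∈ cyclotomicCoset m r a, (X - C (ξ ^ u.val)) := by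
  have hcop : IsUnit (r : ZMod m) := by
    rw [ZMod.isUnit_iff_coprime] at hr ⊢
    exact hr.symm
  have : CharP K r := charP_of_injective_algebraMap (algebraMap (ZMod r) K).injective r
  set p : K[X] := ∏ u ∈ cyclotomicCoset m r a, (X - C (ξ ^ u.val)) with hp
  have hfix : p.map (frobenius K r) = p := by
    rw [hp, Polynomial.map_prod]
    refine Finset.prod_bij (fun u _ => u * r) ?_ ?_ ?_ ?_
    · intro u hu
      simp only [cyclotomicCoset, Finset.mem_filter, Finset.mem_univ, true_and] at hu ⊢
      obtain ⟨k, rfl⟩ := hu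
      exact ⟨k + 1, by rw [pow_succ, mul_assoc]⟩
    · intro u _ v _ h
      exact hcop.mul_left_injective h
    · intro v hv
      simp only [cyclotomicCoset, Finset.mem_filter, Finset.mem_univ, true_and] at hv
      obtain ⟨k, rfl⟩ := hv
      obtain ⟨w, hw⟩ := hcop
      have hN : (r : ZMod m) ^ (orderOf w) = 1 := by
        rw [← hw, ← Units.val_pow_eq_pow_val, pow_orderOf_eq_one, Units.val_one]
      have hpos : 0 < orderOf w := orderOf_pos w
      refine ⟨a * (r : ZMod m) ^ (k + (orderOf w - 1)), ?_, ?_⟩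
      · simp only [cyclotomicCoset, Finset.mem_filter, Finset.mem_univ, true_and]
        exact ⟨_, rfl⟩
      · rw [mul_assoc, ← pow_succ, add_assoc, Nat.sub_add_cancel hpos, pow_add, hN, mul_one]
    · intro u _
      rw [Polynomial.map_sub, map_X, map_C, frobenius_def, ← pow_mul]
      congr 2
      have h1 : (u * (r : ZMod m)).val = (u.val * r) % m := by
        rw [ZMod.val_mul, ZMod.val_natCast, Nat.mul_mod_mod]
      rw [h1]
      exact pow_eq_pow_mod _ hξ.pow_eq_one
  have hl : p ∈ lifts (algebraMap (ZMod r) K) := by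
    rw [lifts_iff_coeff_lifts]
    intro n
    have h1 : p.coeff n ^ r = p.coeff n := by
      conv_rhs => rw [← hfix, coeff_map, frobenius_def]
    have h2 : p.coeff n ∈ (⊥ : Subfield K) := (Subfield.mem_bot_iff_pow_eq_self K r).2 h1
    have h3 : (⊥ : Subfield K) ≤ (algebraMap (ZMod r) K).fieldRange := bot_le
    exact h3 h2
  exact hl

/-- The polynomial `f_χ` over `𝔽_r` for the cyclotomic coset `χ` of `a`: over `K` it is the product
of the factors `X - ξ^u` for `u ∈ χ`, where `ξ` is a primitive `m`-th root of unity. -/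
noncomputable def cosetPoly (hr : IsUnit (m : ZMod r)) (hξ : IsPrimitiveRoot ξ m) (a : ZMod m) :
    (ZMod r)[X] :=
  (exists_cosetPoly hr hξ a).choose

theorem cosetPoly_map (hr : IsUnit (m : ZMod r)) (hξ : IsPrimitiveRoot ξ m) (a : ZMod m) :
    (cosetPoly hr hξ a).map (algebraMap (ZMod r) K) =
      ∏ u ∈ cyclotomicCoset m r a, (X - C (ξ ^ u.val)) :=
  (exists_cosetPoly hr hξ a).choose_spec

theorem cosetPoly_dvd (hr : IsUnit (m : ZMod r)) (hξ : IsPrimitiveRoot ξ m) (a : ZMod m) :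
    cosetPoly hr hξ a ∣ X ^ m - 1 := by
  classical
  rw [← map_dvd_map' (algebraMap (ZMod r) K), cosetPoly_map, Polynomial.map_sub,
    Polynomial.map_pow, map_X, Polynomial.map_one,
    X_pow_sub_one_eq_prod (NeZero.pos m) hξ]
  have hinj : Function.Injective fun u : ZMod m => ξ ^ u.val := by
    intro u v h
    exact ZMod.val_injective m (hξ.pow_inj (ZMod.val_lt u) (ZMod.val_lt v) h)
  rw [← Finset.prod_image (s := cyclotomicCoset m r a) (g := fun u => ξ ^ u.val)
    (f := fun z => X - C z) fun u _ v _ h => hinj h]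
  apply Finset.prod_dvd_prod_of_subset
  intro z hz
  obtain ⟨u, _, rfl⟩ := Finset.mem_image.1 hz
  rw [mem_nthRootsFinset (NeZero.pos m), ← pow_mul, mul_comm, pow_mul, hξ.pow_eq_one, one_pow]

end CyclicModules

section Polynomial

variable {F : Type} [Field F] {m : ℕ} [NeZero m]

/-- `p` is the equivariant polynomial: the graded pieces of the equivariant homology are
finite-dimensional, and the coefficient of `t^i q^k` in the Laurent polynomial `p` is the dimension
over `F` of the graded piece in homological degree `i` and quantum degree `k`. -/
structure IsEquivariantPolynomial (h t : F) {D : LinkDiagram} (σ : D.Rotation m)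
    {M : ModuleCat.{0} (CyclicGroupRing F m)} (P : ProjectiveResolution M)
    (p : AddMonoidAlgebra ℤ (ℤ × ℤ)) : Prop where
  finite : ∀ i k, Module.Finite F
    (RestrictScalars F (CyclicGroupRing F m) (HyperExt.Gr P (LinkDiagram.khComplex h t σ) i k))
  coeff : ∀ i k, p.coeff (i, k) = Module.finrank F
    (RestrictScalars F (CyclicGroupRing F m) (HyperExt.Gr P (LinkDiagram.khComplex h t σ) i k))

end Polynomial

/-! The divisibility comes from linear algebra over a larger field. Let `f` be the polynomial in
question and let `I` be the kernel of `Λ_m → F[X]/(f)`. An element of `I` kills `M = F[X]/(f)`, so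
multiplication by it on a projective resolution lifts the zero endomorphism of `M` and is
null-homotopic. Hence `I` annihilates `Ext^i(M; K)` (`smul_hyperExt_eq_zero`) and also every graded
piece of its filtration (`smul_gr_eq_zero`). If `f` is irreducible, then `I` is maximal, and each
graded piece is a vector space over the field `Λ_m/I ≅ F[X]/(f)`. By the tower formula its dimension
over `F` is a multiple of `deg f` (`finrank_quotient_dvd_finrank`).

That the dimensions form a Laurent polynomial with finite coefficients uses the invertibility of
`m`. By Maschke's theorem `M` is then projective, so every resolution of it is homotopy equivalent
to `M` in degree 0, and a cocycle is determined up to coboundaries by its restriction to a copy of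
`M` in `P_0` (`exists_section`). So `Ext^i` is a subquotient of `Hom(M, K)` and vanishes where `K^i`
does. All that is needed of the cube of resolutions is that it is finite-dimensional, lives in
finitely many homological degrees, and has a filtration that is everything far down and zero far up.

Irreducibility of `f` is classical for cyclotomic polynomials over `ℚ`. Over `𝔽_r` the polynomial of
a cyclotomic coset is a minimal polynomial, because Frobenius acts on the roots `ξ^u` by `u ↦ r u`
(`cosetPoly_eq_minpoly`). Its degree, the size of the coset, is counted in `card_cyclotomicCoset`.
-/

/-! ### Homological algebra of `Ext(M; K)` and its filtration -/

section HyperExt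

variable {Λ : Type} [CommRing Λ] {M : ModuleCat.{0} Λ} (P : ProjectiveResolution M)
  (K : FilteredComplex Λ)

variable {P K} in
/-- Homotopic endomorphisms of the resolution induce the same map on cohomology. -/
theorem comp_sub_comp_mem_extCoboundaries {u v : P.complex ⟶ P.complex} (H : Homotopy u v) {i : ℤ}
    {f : ExtCochain P K} (hf : f ∈ extCocycles P K i) :
    ((fun a => f a ∘ₗ (u.f a).hom - f a ∘ₗ (v.f a).hom) : ExtCochain P K) ∈
      extCoboundaries P K i := by
  obtain ⟨hker, hdeg⟩ := hf
  have hker' : ∀ a, ExtCochain.d P K f a = 0 := fun a => congrFun (LinearMap.mem_ker.1 hker) a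
  -- The cocycle condition in component `a + 1`, solved for its second term; this turns the sign
  -- `(-1)^(a+1)` of the total differential into `(-1)^a`.
  have hsucc : ∀ a x, f a (P.complex.d (a + 1) a x) = (-1 : Λ) ^ a • K.d (f (a + 1) x) := by
    intro a x
    have h1 : (-1 : Λ) ^ (a + 1) • K.d (f (a + 1) x) + f a (P.complex.d (a + 1) a x) = 0 :=
      LinearMap.congr_fun (hker' (a + 1)) x
    rw [pow_succ, mul_neg_one, neg_smul, neg_add_eq_zero] at h1
    exact h1.symm
  -- Composing `f` with the homotopy gives the primitive. Its total degree is `i - 1`, since the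
  -- component on `P_a` takes values in `K^{i-(a+1)}`. By `hsucc` the part of its coboundary that
  -- involves `K.d` becomes `f ∘ ∂H`, and the other part is `f ∘ H∂`; together they give `f ∘ (u -
  -- v)`.
  refine ⟨fun a => f (a + 1) ∘ₗ (H.hom a (a + 1)).hom, ?_, ?_⟩
  · intro a x
    have := hdeg (a + 1) (H.hom a (a + 1) x)
    rw [Nat.cast_succ] at this
    rwa [show i - 1 - (a : ℤ) = i - (a + 1) by ring]
  · funext a
    refine LinearMap.ext fun x => ?_
    have hc := H.comm a
    cases a with
    | zero =>
      rw [Homotopy.dNext_zero_chainComplex, Homotopy.prevD_chainComplex, zero_add] at hc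
      have h2 : u.f 0 x = P.complex.d 1 0 (H.hom 0 1 x) + v.f 0 x := by rw [hc]; rfl
      change K.d (f 1 (H.hom 0 1 x)) = f 0 (u.f 0 x) - f 0 (v.f 0 x)
      rw [h2, map_add, add_sub_cancel_right]
      have := hsucc 0 (H.hom 0 1 x)
      rw [pow_zero, one_smul] at this
      exact this.symm
    | succ a =>
      rw [Homotopy.dNext_succ_chainComplex, Homotopy.prevD_chainComplex] at hc
      have h2 : u.f (a + 1) x = H.hom a (a + 1) (P.complex.d (a + 1) a x) +
          P.complex.d (a + 2) (a + 1) (H.hom (a + 1) (a + 2) x) + v.f (a + 1) x := by rw [hc]; rfl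
      change (-1 : Λ) ^ (a + 1) • K.d (f (a + 2) (H.hom (a + 1) (a + 2) x)) +
        f (a + 1) (H.hom a (a + 1) (P.complex.d (a + 1) a x)) =
          f (a + 1) (u.f (a + 1) x) - f (a + 1) (v.f (a + 1) x)
      rw [h2, map_add, map_add, add_sub_cancel_right, hsucc (a + 1), add_comm]

/-- Scalars that annihilate `M` annihilate `Ext(M; K)`. -/
theorem smul_hyperExt_eq_zero {c : Λ} (hc : ∀ x : M, c • x = 0) {i : ℤ} (z : HyperExt P K i) :
    c • z = 0 := by
  -- Both maps lift the zero endomorphism of `M`, the first one because `c` kills `M`, and two lifts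
  -- of the same map are homotopic.
  have H : Homotopy (c • 𝟙 P.complex) 0 := by
    refine ProjectiveResolution.liftHomotopy (0 : M ⟶ M) _ _ ?_ (by simp)
    apply HomologicalComplex.to_single_hom_ext
    ext x
    have h0 : (P.π ≫ (ChainComplex.single₀ (ModuleCat Λ)).map (0 : M ⟶ M)) = 0 := by simp
    rw [h0]
    change P.π.f 0 (c • x) = 0
    rw [map_smul]
    exact hc _
  obtain ⟨f, rfl⟩ := Submodule.Quotient.mk_surjective _ z
  rw [← Submodule.Quotient.mk_smul, Submodule.Quotient.mk_eq_zero]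
  change c • f.1 ∈ extCoboundaries P K i
  convert comp_sub_comp_mem_extCoboundaries H f.2 using 1
  funext a
  refine LinearMap.ext fun x => ?_
  change c • f.1 a x = f.1 a (c • x) - f.1 a 0
  rw [map_smul, map_zero, sub_zero]

/-- A projective module splits off from its resolution. -/
theorem exists_section [Module.Projective Λ M] :
    ∃ j : M →ₗ[Λ] P.complex.X 0, ∀ i (f : ExtCochain P K), f ∈ extCocycles P K i →
      f 0 ∘ₗ j = 0 → f ∈ extCoboundaries P K i := by
  have : Projective M := (IsProjective.iff_projective M).1 ‹_›
  let p : P.complex.X 0 ⟶ M := P.π.f 0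
  have hepi : Epi p := inferInstanceAs (Epi (P.π.f 0))
  let j : M ⟶ P.complex.X 0 := Projective.factorThru (𝟙 M) p
  have hj : j ≫ p = 𝟙 M := Projective.factorThru_comp _ _
  -- The composite `P → M → P` of the augmentation with its section, where `M` sits in degree 0. It
  -- vanishes in positive degrees.
  let e : P.complex ⟶ P.complex := P.π ≫ (ChainComplex.fromSingle₀Equiv P.complex M).symm j
  have he0 : e.f 0 = p ≫ j := by
    simp only [e, HomologicalComplex.comp_f, ChainComplex.fromSingle₀Equiv_symm_apply_f_zero]
    rfl
  have heS : ∀ a, e.f (a + 1) = 0 := by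
    intro a
    have : P.π.f (a + 1) = 0 :=
      (HomologicalComplex.isZero_single_obj_X (ComplexShape.down ℕ) 0 M (a + 1)
        (Nat.succ_ne_zero a)).eq_zero_of_tgt _
    rw [HomologicalComplex.comp_f, this, Limits.zero_comp]
  -- Both maps lift the identity of `M`, since `j` is a section. So `f` is cohomologous to `f ∘ e`,
  -- whose only component is `f 0 ∘ j ∘ p`; it is zero if `f 0 ∘ j` is.
  have H : Homotopy (𝟙 P.complex) e := by
    refine ProjectiveResolution.liftHomotopy (𝟙 M) _ _ (by simp) ?_
    apply HomologicalComplex.to_single_hom_ext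
    rw [HomologicalComplex.comp_f, he0, Category.assoc]
    change p ≫ j ≫ p = _
    rw [hj, Category.comp_id, CategoryTheory.Functor.map_id, Category.comp_id]
  refine ⟨j.hom, fun i f hf h0 => ?_⟩
  have := comp_sub_comp_mem_extCoboundaries H hf
  convert this using 1
  funext a
  refine LinearMap.ext fun x => ?_
  cases a with
  | zero =>
    rw [he0]
    change f 0 x = f 0 x - (f 0 ∘ₗ j.hom) (p x)
    rw [h0, LinearMap.zero_apply, sub_zero]
  | succ a =>
    rw [heS]
    change f _ x = f _ x - f _ 0
    rw [map_zero, sub_zero]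

/-- Restriction along the section sends cocycles to `Hom(M, K)`, which is noetherian, and by
`exists_section` the kernel consists of coboundaries. So `Ext^i` is a quotient of the image. -/
theorem isNoetherian_hyperExt [Module.Projective Λ M] [Module.Finite Λ M] [IsNoetherian Λ K.X]
    (i : ℤ) : IsNoetherian Λ (HyperExt P K i) := by
  obtain ⟨j, hj⟩ := exists_section P K
  let T : extCocycles P K i →ₗ[Λ] M →ₗ[Λ] K.X :=
    LinearMap.lcomp Λ K.X j ∘ₗ LinearMap.proj 0 ∘ₗ (extCocycles P K i).subtype
  have hT : LinearMap.ker T ≤ (extCoboundaries P K i).submoduleOf (extCocycles P K i) :=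
    fun f hf => hj i f.1 f.2 hf
  have : IsNoetherian Λ (extCocycles P K i ⧸ LinearMap.ker T) :=
    isNoetherian_of_linearEquiv T.quotKerEquivRange.symm
  exact isNoetherian_of_surjective (Submodule.factor hT)
    (LinearMap.range_eq_top.2 (Submodule.factor_surjective hT))

/-- Only the component on `P_0` matters up to coboundaries, and in total degree `i` it takes values
in `K^i`. This bounds the homological degrees of `Ext` although `P` itself may be infinite. -/
theorem subsingleton_hyperExt [Module.Projective Λ M] {i : ℤ} (hi : K.deg i = ⊥) :
    Subsingleton (HyperExt P K i) := by
  obtain ⟨j, hj⟩ := exists_section P K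
  refine subsingleton_of_forall_eq 0 fun z => ?_
  obtain ⟨f, rfl⟩ := Submodule.Quotient.mk_surjective _ z
  rw [Submodule.Quotient.mk_eq_zero]
  refine hj i f.1 f.2 (LinearMap.ext fun x => ?_)
  have := f.2.2 0 (j x)
  rwa [Nat.cast_zero, sub_zero, hi] at this

variable {P K} in
theorem HyperExt.filtration_eq_top {k : ℤ} (hk : K.filtration k = ⊤) (i : ℤ) :
    HyperExt.filtration P K i k = ⊤ := by
  have : (ExtCochain.filtration P K k).submoduleOf (extCocycles P K i) = ⊤ :=
    eq_top_iff.2 fun f _ a x => by rw [hk]; trivial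
  rw [HyperExt.filtration, this, Submodule.map_top, Submodule.range_mkQ]

variable {P K} in
theorem HyperExt.filtration_eq_bot {k : ℤ} (hk : K.filtration k = ⊥) (i : ℤ) :
    HyperExt.filtration P K i k = ⊥ := by
  have : (ExtCochain.filtration P K k).submoduleOf (extCocycles P K i) = ⊥ := by
    refine eq_bot_iff.2 fun f hf => Subtype.ext (funext fun a => LinearMap.ext fun x => ?_)
    have := hf a x
    rwa [hk] at this
  rw [HyperExt.filtration, this, Submodule.map_bot]

-- Here the denominator of the graded piece is already everything, so the hypothesis concerns step
-- `k + 1`; at the other end of the filtration it is the numerator, step `k`, that has to vanish.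
variable {P K} in
theorem HyperExt.subsingleton_gr_of_top {k : ℤ} (hk : K.filtration (k + 1) = ⊤) (i : ℤ) :
    Subsingleton (HyperExt.Gr P K i k) := by
  rw [Submodule.Quotient.subsingleton_iff, HyperExt.filtration_eq_top hk]
  rfl

variable {P K} in
theorem HyperExt.subsingleton_gr_of_bot {k : ℤ} (hk : K.filtration k = ⊥) (i : ℤ) :
    Subsingleton (HyperExt.Gr P K i k) := by
  have : Subsingleton (HyperExt.filtration P K i k) := by
    rw [HyperExt.filtration_eq_bot hk]; infer_instance
  infer_instance

/-- Annihilation passes to submodules and quotients. This makes the graded pieces vector spaces over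
the residue field. -/
theorem smul_gr_eq_zero {c : Λ} (hc : ∀ x : M, c • x = 0) {i k : ℤ} (z : HyperExt.Gr P K i k) :
    c • z = 0 := by
  obtain ⟨y, rfl⟩ := Submodule.Quotient.mk_surjective _ z
  rw [← Submodule.Quotient.mk_smul]
  have : c • y = 0 := Subtype.ext (smul_hyperExt_eq_zero P K hc y.1)
  rw [this, Submodule.Quotient.mk_zero]

end HyperExt

/-! ### Finiteness of the cube of resolutions and of its quantum filtration -/

namespace LinkDiagram

section Chain

variable {F : Type} [Field F] (h t : F) {D : LinkDiagram} {m : ℕ} (σ : D.Rotation m)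

/-- The algebra is generated by the classes of finitely many variables, and each of them is integral
because of the relation `X² = h X + t`. No basis indexed by circles is needed. -/
theorem finite_stateIdeal_quotient (s : D.State) :
    Module.Finite F (D.SiteRing F ⧸ stateIdeal h t s) := by
  have hint : Algebra.IsIntegral F (D.SiteRing F ⧸ stateIdeal h t s) := by
    refine ⟨fun x => ?_⟩
    obtain ⟨p, rfl⟩ := Ideal.Quotient.mk_surjective x
    have hX : ∀ a, IsIntegral F (Ideal.Quotient.mk (stateIdeal h t s) (MvPolynomial.X a)) := by
      intro a
      refine ⟨Polynomial.X ^ 2 - (Polynomial.C h * Polynomial.X + Polynomial.C t), ?_, ?_⟩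
      · exact Polynomial.monic_X_pow_sub Polynomial.degree_linear_lt
      · rw [← Ideal.Quotient.eq_zero_iff_mem.2 (quad_mem h t s a)]
        simp only [Polynomial.eval₂_sub, Polynomial.eval₂_add, Polynomial.eval₂_mul,
          Polynomial.eval₂_pow, Polynomial.eval₂_X, Polynomial.eval₂_C, map_sub, map_pow,
          sub_sub]
        rfl
    induction p using MvPolynomial.induction_on with
    | C a => exact isIntegral_algebraMap (R := F) (x := a)
    | add p q hp hq => rw [map_add]; exact hp.add hq
    | mul_X p a hp => rw [map_mul]; exact hp.mul (hX a)
  have : Algebra.FiniteType F (D.SiteRing F ⧸ stateIdeal h t s) :=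
    Algebra.FiniteType.of_surjective (Ideal.Quotient.mkₐ F _) (Ideal.Quotient.mkₐ_surjective F _)
  exact Algebra.IsIntegral.finite

/-- The relations are imposed vertex by vertex, so the chain space embeds in the product of the
finite-dimensional quotients at the finitely many vertices. -/
instance finite_chain : Module.Finite F (Chain h t σ) := by
  have := fun s => finite_stateIdeal_quotient h t (D := D) s
  let φ : D.PreChain F →ₗ[F] ∀ s, D.SiteRing F ⧸ stateIdeal h t s :=
    LinearMap.pi fun s => (Ideal.Quotient.mkₐ F (stateIdeal h t s)).toLinearMap ∘ₗ LinearMap.proj s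
  have hφ : ∀ f, φ f = 0 → f ∈ stateRel h t := fun f hf s =>
    Ideal.Quotient.eq_zero_iff_mem.1 (congrFun hf s)
  have hφ' : stateRel h t ≤ LinearMap.ker φ := fun f hf =>
    funext fun s => Ideal.Quotient.eq_zero_iff_mem.2 (hf s)
  refine Module.Finite.of_injective ((stateRel h t).liftQ φ hφ')
    ((injective_iff_map_eq_zero ((stateRel h t).liftQ φ hφ')).2 fun x hx => ?_)
  obtain ⟨f, rfl⟩ := Submodule.mkQ_surjective _ x
  exact (Submodule.Quotient.mk_eq_zero _).2 (hφ f hx)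

variable [NeZero m]

/-- The constants in `Λ_m` act through the original `F`-structure, so finiteness over `F` gives
finiteness over `Λ_m`. -/
instance isScalarTower_chain : IsScalarTower F (CyclicGroupRing F m) (Chain h t σ) := by
  refine IsScalarTower.of_algebraMap_smul fun a x => ?_
  change (rotRep h t σ).asAlgebraHom (algebraMap F _ a) x = _
  rw [AlgHom.commutes]
  rfl

instance finite_chain_cyclicGroupRing : Module.Finite (CyclicGroupRing F m) (Chain h t σ) :=
  Module.Finite.of_restrictScalars_finite F _ _

/-- A chain is supported at vertices of the cube, and the finitely many vertices have only finitely
many homological degrees. -/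
theorem finite_setOf_degree_ne_bot : {i | degree h t σ i ≠ ⊥}.Finite := by
  refine (Set.finite_range D.homDegree).subset fun i hi => ?_
  by_contra hn
  refine hi (eq_bot_iff.2 ?_)
  rintro _ ⟨f, hf, rfl⟩
  have : f = 0 := by
    funext s
    by_contra hs
    exact hn ⟨s, hf s hs⟩
  rw [this]
  exact map_zero _

/-- Each variable lowers the quantum degree by 2, so at every vertex the monomial `1` has the
largest degree. Beyond the maximum over the vertices even the representing polynomials vanish. -/
theorem exists_qFiltration_eq_bot : ∃ b, ∀ k, b ≤ k → qFiltration h t σ k = ⊥ := by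
  obtain ⟨b, hb⟩ := (Set.finite_range fun s => D.qDegree s 0).bddAbove
  refine ⟨b + 1, fun k hk => eq_bot_iff.2 ?_⟩
  rintro _ ⟨f, hf, rfl⟩
  have : f = 0 := by
    funext s
    refine MvPolynomial.ext _ _ fun u => ?_
    by_contra hu
    have h1 := hf s u hu
    have h2 : D.qDegree s 0 ≤ b := hb ⟨s, rfl⟩
    unfold qDegree at h1 h2
    rw [map_zero] at h2
    omega
  rw [this]
  exact map_zero _

/-- A representative involves finitely many monomials in all; the smallest of their quantum degrees
is a possible level. -/
theorem exists_mem_qFiltration (x : Chain h t σ) : ∃ b, x ∈ qFiltration h t σ b := by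
  obtain ⟨f, rfl⟩ := Chain.mk_surjective h t σ x
  have hfin : (⋃ s, D.qDegree s '' ((f s).support : Set (D.Site →₀ ℕ))).Finite :=
    Set.finite_iUnion fun s => (Finset.finite_toSet _).image _
  obtain ⟨b, hb⟩ := hfin.bddBelow
  exact ⟨b, f, fun s u hu =>
    hb (Set.mem_iUnion.2 ⟨s, u, MvPolynomial.mem_support_iff.2 hu, rfl⟩), rfl⟩

/-- Quantum degrees of monomials are in general not bounded below, so this cannot be read off from
the polynomial rings. The quotient is finitely generated over `Λ_m`, however, and a lower bound for
the levels of its generators works for all of it. -/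
theorem exists_qFiltration_eq_top : ∃ b, ∀ k, k ≤ b → qFiltration h t σ k = ⊤ := by
  obtain ⟨S, hS⟩ := (finite_chain_cyclicGroupRing h t σ).fg_top
  choose g hg using exists_mem_qFiltration h t σ
  obtain ⟨b, hb⟩ := (S.finite_toSet.image g).bddBelow
  refine ⟨b, fun k hk => ?_⟩
  rw [eq_top_iff, ← hS, Submodule.span_le]
  intro x hx
  exact (khComplex h t σ).filtration_anti (hk.trans (hb ⟨x, hx, rfl⟩)) (hg x)

end Chain

end LinkDiagram

/-! ### Group algebra, residue fields and the modules `F[X]/(f)` -/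

section CyclicModules

open Polynomial

variable {F : Type} [Field F] {m : ℕ} [NeZero m] {f : F[X]} (hf : f ∣ X ^ m - 1)

/-- Dimensions of modules over a residue field are divisible by the degree of the residue field. -/
theorem finrank_quotient_dvd_finrank {Λ N : Type} [CommRing Λ] [Algebra F Λ] [AddCommGroup N]
    [Module Λ N] (I : Ideal Λ) [hI : I.IsMaximal] (hN : ∀ c ∈ I, ∀ z : N, c • z = 0) :
    Module.finrank F (Λ ⧸ I) ∣ Module.finrank F (RestrictScalars F Λ N) := by
  let _ : Module F N := RestrictScalars.module F Λ N
  have : IsScalarTower F Λ N := RestrictScalars.isScalarTower F Λ N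
  -- Being killed by `I`, the module `N` becomes a vector space over the field `Λ/I`, compatibly
  -- with `F`.
  have htors : Module.IsTorsionBySet Λ N I := fun z c => hN c c.2 z
  let _ := htors.module
  let _ := Ideal.Quotient.field I
  have : IsScalarTower F (Λ ⧸ I) N := htors.isScalarTower
  -- The tower formula. It needs no finiteness, because `finrank` is 0 in the infinite-dimensional
  -- case.
  exact ⟨_, (Module.finrank_mul_finrank F (Λ ⧸ I) N).symm⟩

theorem finite_restrictScalars {Λ N : Type} [CommRing Λ] [Algebra F Λ] [Module.Finite F Λ]
    [AddCommGroup N] [Module Λ N] [Module.Finite Λ N] :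
    Module.Finite F (RestrictScalars F Λ N) := by
  let _ : Module F N := RestrictScalars.module F Λ N
  have : IsScalarTower F Λ N := RestrictScalars.isScalarTower F Λ N
  exact Module.Finite.trans Λ N

theorem generatorHom_single :
    generatorHom f hf (MonoidAlgebra.of F _ (Multiplicative.ofAdd 1)) = AdjoinRoot.root f := by
  rw [generatorHom, MonoidAlgebra.lift_of]
  change AdjoinRoot.root f ^ (1 : ZMod m).val = _
  -- The exponent is the representative of `1 : ZMod m`. It is 1 except for `m = 1`, where it is 0;
  -- but then `f` divides `X - 1` and the root is 1 anyway.
  rcases Nat.lt_or_ge 1 m with h | h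
  · have : Fact (1 < m) := ⟨h⟩
    rw [ZMod.val_one, pow_one]
  · obtain rfl : m = 1 := le_antisymm h (NeZero.pos m)
    have := root_pow_eq_one hf
    rw [pow_one] at this
    rw [this, one_pow]

/-- The algebra `F[X]/(f)` is generated by the class of `X`, which is the image of the generator of
the group. -/
theorem generatorHom_surjective : Function.Surjective (generatorHom f hf) := by
  intro y
  obtain ⟨p, rfl⟩ := AdjoinRoot.mk_surjective y
  refine ⟨aeval (MonoidAlgebra.of F _ (Multiplicative.ofAdd 1)) p, ?_⟩
  rw [← aeval_algHom_apply, generatorHom_single, AdjoinRoot.aeval_eq]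

/-- The image is a field when `f` is irreducible. This kernel is the ideal whose residue field acts
on the graded pieces. -/
theorem ker_generatorHom_isMaximal (hirr : Irreducible f) :
    (RingHom.ker (generatorHom f hf)).IsMaximal := by
  have : Fact (Irreducible f) := ⟨hirr⟩
  exact RingHom.ker_isMaximal_of_surjective _ (generatorHom_surjective hf)

theorem smul_cyclicModule_eq_zero {c : CyclicGroupRing F m}
    (hc : c ∈ RingHom.ker (generatorHom f hf)) (x : cyclicModule f hf) : c • x = 0 := by
  have h0 : generatorHom f hf c = 0 := hc
  change generatorHom f hf c * (show AdjoinRoot f from x) = 0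
  rw [h0, zero_mul]

theorem finite_cyclicModule : Module.Finite (CyclicGroupRing F m) (cyclicModule f hf) := by
  let φ : CyclicGroupRing F m →ₗ[CyclicGroupRing F m] cyclicModule f hf :=
    LinearMap.toSpanSingleton _ _ (1 : AdjoinRoot f)
  refine Module.Finite.of_surjective φ fun y => ?_
  obtain ⟨c, hc⟩ := generatorHom_surjective hf y
  refine ⟨c, ?_⟩
  change generatorHom f hf c * 1 = _
  rw [mul_one, hc]

/-- The group algebra is semisimple if the order of the group is invertible. -/
theorem projective_of_natCast_ne_zero (hm : (m : F) ≠ 0) (N : Type) [AddCommGroup N]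
    [Module (CyclicGroupRing F m) N] : Module.Projective (CyclicGroupRing F m) N := by
  -- The hypothesis of Maschke's theorem, in the form in which instance search finds semisimplicity
  -- of the group algebra; over a semisimple ring every module is projective.
  have : NeZero (Nat.card (Multiplicative (ZMod m)) : F) := by
    refine ⟨?_⟩
    rwa [Nat.card_congr Multiplicative.toAdd, Nat.card_zmod]
  exact Module.projective_of_isSemisimpleRing _ _

end CyclicModules

/-! ### Existence and divisibility of the equivariant polynomial -/

section Polynomial

open Polynomial LinkDiagram

variable {F : Type} [Field F] {m : ℕ} [NeZero m] {f : F[X]} (hf : f ∣ X ^ m - 1)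

/-- The equivariant polynomial with coefficients in `F[X] / (f)`, for `f` irreducible. -/
theorem exists_isEquivariantPolynomial (hm : (m : F) ≠ 0) (hirr : Irreducible f) (h t : F)
    {D : LinkDiagram} (σ : D.Rotation m) (P : ProjectiveResolution (cyclicModule (m := m) f hf)) :
    ∃ p : AddMonoidAlgebra ℤ (ℤ × ℤ), IsEquivariantPolynomial h t σ P p ∧
      ∀ i k, (Module.finrank F (AdjoinRoot f) : ℤ) ∣ p.coeff (i, k) := by
  let K := khComplex h t σ
  have hproj := projective_of_natCast_ne_zero hm (cyclicModule f hf)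
  have hfin := finite_cyclicModule hf
  have hart : Module.Finite F (CyclicGroupRing F m) :=
    inferInstanceAs (Module.Finite F (MonoidAlgebra F (Multiplicative (ZMod m))))
  have hnoeth : IsNoetherianRing (CyclicGroupRing F m) := isNoetherian_of_tower F inferInstance
  have hX : Module.Finite (CyclicGroupRing F m) K.X := finite_chain_cyclicGroupRing h t σ
  let G : ℤ → ℤ → Type := fun i k =>
    RestrictScalars F (CyclicGroupRing F m) (HyperExt.Gr P K i k)
  -- A graded piece is a subquotient of a noetherian `Λ_m`-module, and `Λ_m` is finite over `F`.
  have hG : ∀ i k, Module.Finite F (G i k) := by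
    intro i k
    have := isNoetherian_hyperExt P K i
    exact finite_restrictScalars
  obtain ⟨a, ha⟩ := exists_qFiltration_eq_top h t σ
  obtain ⟨b, hb⟩ := exists_qFiltration_eq_bot h t σ
  -- The nonzero coefficients lie in a finite box: finitely many homological degrees by
  -- `subsingleton_hyperExt`, and quantum degrees between the levels where the filtration is
  -- everything and zero. For `k < a` it is step `k + 1 ≤ a` that is everything.
  have hsupp : ∀ i k, Module.finrank F (G i k) ≠ 0 →
      degree h t σ i ≠ ⊥ ∧ k ∈ Set.Icc a b := by
    intro i k hne
    have key : ¬ Subsingleton (HyperExt.Gr P K i k) := fun hs =>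
      hne (@Module.finrank_zero_of_subsingleton F (G i k) _ _ _ _ hs)
    refine ⟨fun hi => key ?_, ?_, ?_⟩
    · have : Subsingleton (HyperExt P K i) := subsingleton_hyperExt P K hi
      infer_instance
    · by_contra hk
      exact key (HyperExt.subsingleton_gr_of_top (ha (k + 1) (by omega)) i)
    · by_contra hk
      exact key (HyperExt.subsingleton_gr_of_bot (hb k (by omega)) i)
  let p : ℤ × ℤ →₀ ℤ := Finsupp.onFinset
    ((finite_setOf_degree_ne_bot h t σ).prod (Set.finite_Icc a b)).toFinset
    (fun x => (Module.finrank F (G x.1 x.2) : ℤ)) fun x hx => by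
      rw [Set.Finite.mem_toFinset]
      exact hsupp x.1 x.2 (Nat.cast_ne_zero.1 hx)
  refine ⟨AddMonoidAlgebra.ofCoeff p, ⟨hG, fun i k => rfl⟩, fun i k => ?_⟩
  have hmax := ker_generatorHom_isMaximal hf hirr
  -- The residue field at the kernel is `F[X]/(f)`, so its degree over `F` is the divisor wanted.
  have e := (Ideal.quotientKerAlgEquivOfSurjective
    (generatorHom_surjective hf)).toLinearEquiv.finrank_eq
  rw [← e]
  exact Int.natCast_dvd_natCast.2 (finrank_quotient_dvd_finrank (N := HyperExt.Gr P K i k) _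
    fun c hc z => smul_gr_eq_zero P K (smul_cyclicModule_eq_zero hf hc) z)

end Polynomial

/-! ### Cyclotomic cosets and minimal polynomials of roots of unity -/

section CyclotomicCosets

open Polynomial

variable {m r : ℕ} [NeZero m]

/-- A cyclotomic coset has as many elements as the order of `r` modulo `m / gcd(a, m)`. -/
theorem card_cyclotomicCoset (hr : IsUnit (r : ZMod m)) (a : ZMod m) :
    (cyclotomicCoset m r a).card = orderOf (r : ZMod (m / Nat.gcd a.val m)) := by
  classical
  set g := Nat.gcd a.val m with hg
  have hgm : g ∣ m := Nat.gcd_dvd_right _ _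
  have hg0 : 0 < g := Nat.gcd_pos_of_pos_right _ (NeZero.pos m)
  obtain ⟨n, hn⟩ := hgm
  have hdiv : m / g = n := by rw [hn, Nat.mul_div_cancel_left _ hg0]
  rw [hdiv]
  have hn0 : NeZero n := ⟨by rintro rfl; exact NeZero.ne m (by rw [hn, mul_zero])⟩
  obtain ⟨b, hb⟩ : g ∣ a.val := Nat.gcd_dvd_left _ _
  have hcop : Nat.Coprime n b := by
    have h1 : Nat.gcd (g * b) (g * n) = g * 1 := by rw [← hb, ← hn, mul_one]
    rw [Nat.gcd_mul_left] at h1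
    exact (Nat.gcd_comm _ _).trans (Nat.eq_of_mul_eq_mul_left hg0 h1)
  have hrn : Nat.Coprime r n := by
    rw [ZMod.isUnit_iff_coprime] at hr
    exact hr.coprime_dvd_right ⟨g, by rw [hn, mul_comm]⟩
  -- With `m = g n` and `a = g b`, where `b` is prime to `n`, a congruence modulo `m` between
  -- multiples of `a` can be divided first by `g`, which changes the modulus to `n`, and then by
  -- `b`.
  have hpow : ∀ k l : ℕ, a * (r : ZMod m) ^ k = a * (r : ZMod m) ^ l ↔
      (r : ZMod n) ^ k = (r : ZMod n) ^ l := by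
    intro k l
    have e : ∀ k : ℕ, a * (r : ZMod m) ^ k = ((g * (b * r ^ k) : ℕ) : ZMod m) := by
      intro k
      conv_lhs => rw [← ZMod.natCast_zmod_val a, hb]
      push_cast
      ring
    rw [e, e, ZMod.natCast_eq_natCast_iff, ← Nat.cast_pow, ← Nat.cast_pow,
      ZMod.natCast_eq_natCast_iff]
    conv_lhs => rw [hn]
    constructor
    · intro h
      exact Nat.ModEq.cancel_left_of_coprime hcop (Nat.ModEq.mul_left_cancel' hg0.ne' h)
    · intro h
      exact (h.mul_left b).mul_left' g
  -- `orderOf` would be 0 for an element of infinite order; as `r` is a unit modulo `n`, it is the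
  -- true period.
  have hfin : 0 < orderOf (r : ZMod n) := by
    rw [← ZMod.coe_unitOfCoprime r hrn, orderOf_units]
    exact orderOf_pos _
  -- By `hpow` the sequence `a r^k` repeats exactly with the period of `r^k` modulo `n`, so one
  -- period lists the coset without repetition.
  have himg : cyclotomicCoset m r a =
      (Finset.range (orderOf (r : ZMod n))).image fun k => a * (r : ZMod m) ^ k := by
    ext x
    simp only [cyclotomicCoset, Finset.mem_filter, Finset.mem_univ, true_and, Finset.mem_image,
      Finset.mem_range]
    constructor
    · rintro ⟨k, rfl⟩
      exact ⟨k % orderOf (r : ZMod n), Nat.mod_lt _ hfin, (hpow _ _).2 (pow_mod_orderOf _ _)⟩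
    · rintro ⟨k, _, rfl⟩
      exact ⟨k, rfl⟩
  rw [himg, Finset.card_image_of_injOn, Finset.card_range]
  intro k hk l hl h
  exact pow_injOn_Iio_orderOf (Finset.mem_range.1 hk) (Finset.mem_range.1 hl) ((hpow k l).1 h)

variable [Fact r.Prime] {K : Type} [Field K] [Algebra (ZMod r) K] {ξ : K}

theorem cosetPoly_monic (hr : IsUnit (m : ZMod r)) (hξ : IsPrimitiveRoot ξ m) (a : ZMod m) :
    (cosetPoly hr hξ a).Monic := by
  apply monic_of_injective (algebraMap (ZMod r) K).injective
  rw [cosetPoly_map]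
  exact monic_prod_X_sub_C _ _

theorem cosetPoly_natDegree (hr : IsUnit (m : ZMod r)) (hξ : IsPrimitiveRoot ξ m) (a : ZMod m) :
    (cosetPoly hr hξ a).natDegree = orderOf (r : ZMod (m / Nat.gcd a.val m)) := by
  have hcop : IsUnit (r : ZMod m) := by
    rw [ZMod.isUnit_iff_coprime] at hr ⊢
    exact hr.symm
  rw [← natDegree_map (algebraMap (ZMod r) K), cosetPoly_map, natDegree_prod_of_monic _ _
    fun u _ => monic_X_sub_C _]
  simp only [natDegree_X_sub_C, Finset.sum_const, smul_eq_mul, mul_one]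
  exact card_cyclotomicCoset hcop a

/-- The polynomial of the coset of `a` is the minimal polynomial of `ξ ^ a`. -/
theorem cosetPoly_eq_minpoly (hr : IsUnit (m : ZMod r)) (hξ : IsPrimitiveRoot ξ m) (a : ZMod m) :
    cosetPoly hr hξ a = minpoly (ZMod r) (ξ ^ a.val) := by
  have ha : a ∈ cyclotomicCoset m r a := by
    simp only [cyclotomicCoset, Finset.mem_filter, Finset.mem_univ, true_and]
    exact ⟨0, by rw [pow_zero, mul_one]⟩
  have hroot : aeval (ξ ^ a.val) (cosetPoly hr hξ a) = 0 := by
    rw [aeval_def, ← Polynomial.eval_map, cosetPoly_map, eval_prod]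
    exact Finset.prod_eq_zero ha (by simp)
  have hmon := cosetPoly_monic hr hξ a
  have hint : IsIntegral (ZMod r) (ξ ^ a.val) := ⟨_, hmon, hroot⟩
  -- Two monic polynomials that divide each other are equal. The minimal polynomial divides because
  -- `ξ^a` is a root of the product; the converse needs all conjugates.
  refine (eq_of_monic_of_associated (minpoly.monic hint) hmon
    (associated_of_dvd_dvd (minpoly.dvd _ _ hroot) ?_)).symm
  -- Frobenius fixes the coefficients in `𝔽_r`, so it maps roots of the minimal polynomial to roots;
  -- iterating it reaches the whole coset.
  have hfrob : ∀ k : ℕ, aeval ((ξ ^ a.val) ^ r ^ k) (minpoly (ZMod r) (ξ ^ a.val)) = 0 := by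
    intro k
    induction k with
    | zero => rw [pow_zero, pow_one, minpoly.aeval]
    | succ k ih =>
      have := congrArg (FiniteField.frobeniusAlgHom (ZMod r) K) ih
      rw [← aeval_algHom_apply, map_zero, FiniteField.coe_frobeniusAlgHom, ZMod.card] at this
      rwa [pow_succ, pow_mul]
  rw [← map_dvd_map' (algebraMap (ZMod r) K), cosetPoly_map]
  -- Distinct residues `u` give distinct powers `ξ^u`, because `ξ` is primitive. The linear factors
  -- are then pairwise coprime, and it suffices that each of them divides.
  refine Finset.prod_dvd_of_coprime ?_ ?_
  · intro u _ v _ huv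
    refine pairwise_coprime_X_sub_C (s := fun u : ZMod m => ξ ^ u.val) ?_ huv
    intro u v h
    exact ZMod.val_injective m (hξ.pow_inj (ZMod.val_lt u) (ZMod.val_lt v) h)
  · intro u hu
    simp only [cyclotomicCoset, Finset.mem_filter, Finset.mem_univ, true_and] at hu
    obtain ⟨k, rfl⟩ := hu
    rw [dvd_iff_isRoot, IsRoot.def, Polynomial.eval_map, ← aeval_def]
    have h1 : (a * (r : ZMod m) ^ k).val = (a.val * r ^ k) % m := by
      rw [← Nat.cast_pow, ZMod.val_mul, ZMod.val_natCast, Nat.mul_mod_mod]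
    rw [h1, ← pow_eq_pow_mod _ hξ.pow_eq_one, pow_mul]
    exact hfrob k

/-- A minimal polynomial of an integral element of a field is irreducible, and powers of `ξ` are
integral because `ξ^m = 1`. -/
theorem cosetPoly_irreducible (hr : IsUnit (m : ZMod r)) (hξ : IsPrimitiveRoot ξ m) (a : ZMod m) :
    Irreducible (cosetPoly hr hξ a) := by
  rw [cosetPoly_eq_minpoly]
  have h1 : IsIntegral (ZMod r) ξ :=
    ⟨X ^ m - 1, monic_X_pow_sub_C 1 (NeZero.ne m), by simp [hξ.pow_eq_one]⟩
  exact minpoly.irreducible (h1.pow _)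

end CyclotomicCosets

/-! ### Dimension of `F[X]/(f)` and conclusion -/

theorem finrank_adjoinRoot {F : Type} [Field F] {f : Polynomial F} (hf : f ≠ 0) :
    Module.finrank F (AdjoinRoot f) = f.natDegree :=
  (AdjoinRoot.powerBasis hf).finrank.trans (AdjoinRoot.powerBasis_dim hf)

/-- Both parts are instances of `exists_isEquivariantPolynomial`. They differ only in why the
polynomial is irreducible and in how its degree is computed. -/
theorem mainTheorem11 (m : ℕ) [NeZero m] (hm : 1 < m) (D : LinkDiagram) (σ : D.Rotation m) :
    (∀ (h t : ℚ) (d : ℕ) (hd : d ∣ m)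
      (P : ProjectiveResolution
        (cyclicModule (m := m) (Polynomial.cyclotomic d ℚ) (cyclotomic_dvd ℚ hd))),
      Module.finrank ℚ (AdjoinRoot (Polynomial.cyclotomic d ℚ)) = d.totient ∧
      ∃ p : AddMonoidAlgebra ℤ (ℤ × ℤ), IsEquivariantPolynomial h t σ P p ∧
        ∀ i k, (d.totient : ℤ) ∣ p.coeff (i, k)) ∧
    (∀ (r : ℕ) [Fact r.Prime] (hr : IsUnit (m : ZMod r)) (h t : ZMod r)
      (K : Type) [Field K] [Algebra (ZMod r) K] (ξ : K) (hξ : IsPrimitiveRoot ξ m) (a : ZMod m)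
      (P : ProjectiveResolution
        (cyclicModule (m := m) (cosetPoly hr hξ a) (cosetPoly_dvd hr hξ a))),
      Module.finrank (ZMod r) (AdjoinRoot (cosetPoly hr hξ a)) =
        orderOf (r : ZMod (m / Nat.gcd a.val m)) ∧
      ∃ p : AddMonoidAlgebra ℤ (ℤ × ℤ), IsEquivariantPolynomial h t σ P p ∧
        ∀ i k, (Module.finrank (ZMod r) (AdjoinRoot (cosetPoly hr hξ a)) : ℤ) ∣ p.coeff (i, k)) := by
  refine ⟨fun h t d hd P => ?_, fun r _ hr h t K _ _ ξ hξ a P => ?_⟩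
  · have hd0 : 0 < d := Nat.pos_of_dvd_of_pos hd (NeZero.pos m)
    have hdim : Module.finrank ℚ (AdjoinRoot (Polynomial.cyclotomic d ℚ)) = d.totient := by
      rw [finrank_adjoinRoot (Polynomial.cyclotomic_ne_zero d ℚ), Polynomial.natDegree_cyclotomic]
    have := exists_isEquivariantPolynomial (cyclotomic_dvd ℚ hd) (Nat.cast_ne_zero.2 (NeZero.ne m))
      (Polynomial.cyclotomic.irreducible_rat hd0) h t σ P
    rw [hdim] at this
    exact ⟨hdim, this⟩
  · have hdim := finrank_adjoinRoot (cosetPoly_monic hr hξ a).ne_zero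
    exact ⟨hdim.trans (cosetPoly_natDegree hr hξ a),
      exists_isEquivariantPolynomial (cosetPoly_dvd hr hξ a) hr.ne_zero
        (cosetPoly_irreducible hr hξ a) h t σ P⟩
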